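/- Let $[n]=\{1,\dots,n\}$ and let $\binom{[n]}{k}$ be the set of all $k$-element subsets of $[n]$. Two families $\mathcal A,\mathcal B\subset\binom{[n]}{k}$ are called cross $t$-intersecting if $|A\cap B|\ge t$ for all $A\in\mathcal A$ and $B\in\mathcal B$. They are called isomorphic, written $\mathcal A\cong\mathcal B$, if there is a permutation $f$ of $[n]$ with $\mathcal A=\{\{f(b):b\in B\}:B\in\mathcal B\}$. For $i\ge 0$ let $$\mathcal F_i^t(n,k)=\Big\{F\in\binom{[n]}{k}:|F\cap[t+2i]|\ge t+i\Big\}.$$ Theorem. For every integer $t\ge 14$ there is an integer $k_0\ge t$ such that for all integers $k>k_0$ and $n\ge (t+1)(k-t+1)$ the following holds. If $\mathcal A,\mathcal B\subset\binom{[n]}{k}$ are cross $t$-intersecting, then $$|\mathcal A|\,|\mathcal B|\le\binom{n-t}{k-t}^2.$$ Moreover, equality holds if and only if either $\mathcal A=\mathcal B\cong\mathcal F_0^t(n,k)$, or $n=(t+1)(k-t+1)$ and $\mathcal A=\mathcal B\cong\mathcal F_1^t(n,k)$. -/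

import Mathlib

namespace CrossIntersecting

/-- The family of all `k`-element subsets of `[n]`.  The ground set `[n] = {1, …, n}` is modelled
by `Fin n`, the element `x : Fin n` standing for the integer `x + 1`. -/
def uniformSets (n k : ℕ) : Finset (Finset (Fin n)) :=
  Finset.powersetCard k Finset.univ

/-- The initial segment `[m] = {1, …, m}` of `[n]`. -/
def initSeg (n m : ℕ) : Finset (Fin n) :=
  Finset.univ.filter (fun x => (x : ℕ) < m)

/-- `𝒜` and `ℬ` are cross `t`-intersecting. -/
def IsCrossIntersecting {n : ℕ} (t : ℕ) (𝒜 ℬ : Finset (Finset (Fin n))) : Prop :=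
  ∀ A ∈ 𝒜, ∀ B ∈ ℬ, t ≤ (A ∩ B).card

/-- The family of all `k`-subsets `F` of `[n]` with `|F ∩ [t + 2i]| ≥ t + i`. -/
def frankl (t i n k : ℕ) : Finset (Finset (Fin n)) :=
  (uniformSets n k).filter (fun F => t + i ≤ (F ∩ initSeg n (t + 2 * i)).card)

/-- `𝒜 ≅ ℬ`: some permutation of `[n]` carries `ℬ` onto `𝒜`. -/
def Isomorphic {n : ℕ} (𝒜 ℬ : Finset (Finset (Fin n))) : Prop :=
  ∃ f : Equiv.Perm (Fin n), 𝒜 = ℬ.image (fun B => B.image f)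

end CrossIntersecting

/-!
The proof combines shifting with the counting of lattice walks; all estimates are explicit, and
`k₀ = 2 t` works.  Throughout `K = k - t` and `M = (n - t).choose K`.

A `k`-set is read as a walk that goes up at the steps in the set and right at the others.  For
shifted cross `t`-intersecting families, any `A ∈ 𝒜` and `B ∈ ℬ` have at least `m + t` elements
together among the first `m` integers, for some `m` (`exists_add_le_pre_add_pre`).  Let `u` and `v`
be the largest levels such that all walks of `𝒜` reach the line `y = x + u` and all walks of `ℬ`
reach `y = x + v`; by the reflection principle `|𝒜| ≤ n.choose (k - u)`, and similarly for `ℬ`.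
The criterion gives `u + v ≥ 2 t`.  If `u + v > 2 t`, or if every walk of one of the families
touches its line twice or crosses it, the product of the bounds is at most
`2 * n.choose K * n.choose (K - 1)`, which is less than `M ^ 2` because
`2 (1 + 1 / t) ^ (2 t) < t`; this is where `t ≥ 14` comes from
(`two_mul_choose_mul_choose_lt`).

Otherwise some walk of either family touches its line exactly once, and the criterion forces all
walks that do not cross to touch their line after the same number of steps
(`exists_common_touch`), say at `(i, u + i)` in `𝒜` and at `(i + s, v + i + s)` in `ℬ`, where
`u = t + s` and `v = t - s`, by symmetry with `v ≤ u`.  The number of such walks is governed by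
ballot numbers of size about `1 / i!` and `1 / (i + s)!` relative to the main term, so that the product is less than `M ^ 2`
unless `i + s ≤ 1` (`touch_product_lt`).  Three critical pairs of touching points remain.  There
each family is compared with the slice of all walks on or above its touching point.  If `𝒜` is not
contained in its slice, let `l ≥ 1` be such that all its walks outside the slice reach
`y = x + u + l`, but not all reach the next line.  What `𝒜` gains is at most
`n.choose (k - u - l)`, while the criterion excludes from `ℬ` all walks that pass through its
touching point in a suitable way, go right `l + 1` times and never make a net gain afterwards
(`exists_gain_loss`).  This loss outweighs the gain (`gain_lt_loss`), so the product is at most that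
of the slices, with equality only for the slices themselves (`card_mul_card_le_of_gain_loss`), and
the products of the slices are compared with `M ^ 2` directly.

For arbitrary families one shifts until both are shifted.  When a shift of both families yields the
same extremal slice, the families were already equal and isomorphic to it
(`exists_eq_slice_of_shift_eq`), which carries the description of equality back.
-/

namespace CrossIntersecting

open Finset

/-! ### Sets of integers as lattice walks -/

/-- The number of elements of `F` among the first `m` integers `0, …, m - 1`.  Reading `F` as the
walk that goes up at the step `x` if `x ∈ F` and right otherwise, this is the height after `m`
steps. -/
def pre (F : Finset ℕ) (m : ℕ) : ℕ := (F ∩ range m).card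

/-- The walk of `F` reaches the line `y = x + u`. -/
def Hits (u : ℕ) (F : Finset ℕ) : Prop := ∃ m, m + u ≤ 2 * pre F m

/-- The walk of `F` is on or above the line `y = x + u` after two different numbers of steps. -/
def HitsTwice (u : ℕ) (F : Finset ℕ) : Prop :=
  ∃ m m', m < m' ∧ m + u ≤ 2 * pre F m ∧ m' + u ≤ 2 * pre F m'

/-- `𝒜` is shifted: replacing an element of a member by a smaller one gives a member. -/
def LeftClosed (𝒜 : Finset (Finset ℕ)) : Prop :=
  ∀ A ∈ 𝒜, ∀ i j, i < j → j ∈ A → i ∉ A → insert i (A.erase j) ∈ 𝒜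

/-- Cross `t`-intersection for families of finite sets over any ground type. -/
def Cross {α : Type*} [DecidableEq α] (t : ℕ) (𝒜 ℬ : Finset (Finset α)) : Prop :=
  ∀ A ∈ 𝒜, ∀ B ∈ ℬ, t ≤ (A ∩ B).card

lemma Cross.symm {α : Type*} [DecidableEq α] {t : ℕ} {𝒜 ℬ : Finset (Finset α)}
    (h : Cross t 𝒜 ℬ) : Cross t ℬ 𝒜 := fun B hB A hA => by
  rw [inter_comm]; exact h A hA B hB

@[simp] lemma pre_zero (F : Finset ℕ) : pre F 0 = 0 := by simp [pre]

lemma pre_succ (F : Finset ℕ) (m : ℕ) : pre F (m + 1) = pre F m + if m ∈ F then 1 else 0 := by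
  unfold pre
  rw [range_add_one]
  split_ifs with h
  · rw [inter_insert_of_mem h, card_insert_of_notMem (by simp)]
  · rw [inter_insert_of_notMem h, add_zero]

lemma pre_le (F : Finset ℕ) (m : ℕ) : pre F m ≤ m := by
  simpa [pre] using card_le_card (inter_subset_right : F ∩ range m ⊆ range m)

lemma pre_le_card (F : Finset ℕ) (m : ℕ) : pre F m ≤ F.card :=
  card_le_card inter_subset_left

lemma pre_mono (F : Finset ℕ) {m m' : ℕ} (h : m ≤ m') : pre F m ≤ pre F m' :=
  card_le_card (inter_subset_inter_left (range_subset_range.2 h))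

lemma pre_add_le (F : Finset ℕ) {m m' : ℕ} (h : m ≤ m') : pre F m' + m ≤ pre F m + m' := by
  induction m', h using Nat.le_induction with
  | base => omega
  | succ x hx ih => rw [pre_succ]; split_ifs <;> omega

lemma pre_eq_card {F : Finset ℕ} {n m : ℕ} (hF : F ⊆ range n) (h : n ≤ m) :
    pre F m = F.card := by
  unfold pre
  rw [inter_eq_left.2 (hF.trans (range_subset_range.2 h))]

lemma pre_lt_of_notMem {F : Finset ℕ} {x m : ℕ} (hx : x ∉ F) (h : x < m) : pre F m < m := by
  have h1 := pre_add_le F (show x + 1 ≤ m from h)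
  have h2 := pre_succ F x
  rw [if_neg hx] at h2
  have := pre_le F x
  omega

lemma pre_congr {F G : Finset ℕ} {m : ℕ} (h : ∀ x < m, x ∈ F ↔ x ∈ G) : pre F m = pre G m := by
  unfold pre
  congr 1
  ext x
  simp only [mem_inter, mem_range]
  exact ⟨fun ⟨a, b⟩ => ⟨(h x b).1 a, b⟩, fun ⟨a, b⟩ => ⟨(h x b).2 a, b⟩⟩

lemma pre_insert_of_le {F : Finset ℕ} {x m : ℕ} (h : m ≤ x) : pre (insert x F) m = pre F m :=
  pre_congr fun y hy => by
    rw [mem_insert]; exact ⟨fun h' => h'.resolve_left (by omega), Or.inr⟩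

lemma pre_replace {A : Finset ℕ} {i j : ℕ} (hij : i < j) (hj : j ∈ A) (hi : i ∉ A) (m : ℕ) :
    pre (insert i (A.erase j)) m = pre A m + if i < m ∧ m ≤ j then 1 else 0 := by
  induction m with
  | zero => simp
  | succ m ih =>
    rw [pre_succ, pre_succ, ih]
    rcases lt_trichotomy m i with h | rfl | h
    · have : (m ∈ insert i (A.erase j)) = (m ∈ A) := by
        simp only [mem_insert, mem_erase, eq_iff_iff]
        constructor
        · rintro (h' | h'); exacts [absurd h' (by omega), h'.2]
        · intro h'; exact Or.inr ⟨by omega, h'⟩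
      simp only [this]
      rw [if_neg (by omega : ¬ (i < m ∧ m ≤ j)), if_neg (by omega : ¬ (i < m + 1 ∧ m + 1 ≤ j))]
      omega
    · rw [if_pos (mem_insert_self _ _), if_neg hi, if_neg (by omega : ¬ (m < m ∧ m ≤ j)),
        if_pos (by omega : m < m + 1 ∧ m + 1 ≤ j)]
    · rcases eq_or_ne m j with rfl | hmj
      · have hm : m ∉ insert i (A.erase m) := by simp; omega
        rw [if_neg hm, if_pos hj, if_pos ⟨h, le_rfl⟩,
          if_neg (by omega : ¬ (i < m + 1 ∧ m + 1 ≤ m))]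
      · have : (m ∈ insert i (A.erase j)) = (m ∈ A) := by
          simp only [mem_insert, mem_erase, eq_iff_iff]
          constructor
          · rintro (h' | h'); exacts [absurd h' (by omega), h'.2]
          · intro h'; exact Or.inr ⟨hmj, h'⟩
        simp only [this]
        have e : (i < m ∧ m ≤ j) ↔ (i < m + 1 ∧ m + 1 ≤ j) := by omega
        simp only [e]
        omega

lemma Hits.mono {u v : ℕ} {F : Finset ℕ} (h : Hits u F) (hv : v ≤ u) : Hits v F := by
  obtain ⟨m, hm⟩ := h
  exact ⟨m, by omega⟩

lemma hits_zero (F : Finset ℕ) : Hits 0 F := ⟨0, by simp⟩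

lemma Hits.le_card {u : ℕ} {F : Finset ℕ} (h : Hits u F) : u ≤ F.card := by
  obtain ⟨m, hm⟩ := h
  have := pre_le F m
  have := pre_le_card F m
  omega

lemma two_mul_pre_le_of_not_hits {u : ℕ} {F : Finset ℕ} (h : ¬ Hits (u + 1) F) (m : ℕ) :
    2 * pre F m ≤ m + u := by
  by_contra h'
  exact h ⟨m, by omega⟩

/-- A walk that reaches the line `y = x + (u + 1)` was on the line `y = x + u` before. -/
lemma Hits.hitsTwice {u : ℕ} {F : Finset ℕ} (h : Hits (u + 1) F) : HitsTwice u F := by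
  classical
  have hm := Nat.find_spec h
  set m := Nat.find h with hmdef
  rcases m with _ | m
  · simp at hm
  · refine ⟨m, m + 1, Nat.lt_succ_self m, ?_, by omega⟩
    rw [pre_succ] at hm
    split_ifs at hm <;> omega

/-! ### The prefix criterion for shifted families -/

lemma pre_add_pre_of_forall_mem_union {A B : Finset ℕ} {m x : ℕ} (hmx : m ≤ x)
    (h : ∀ z, m ≤ z → z < x → z ∈ A ∪ B) :
    pre A m + pre B m + (x - m) ≤ pre A x + pre B x := by
  induction x, hmx using Nat.le_induction with
  | base => omega
  | succ x hx ih =>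
    have h1 := ih fun z hz hz' => h z hz (by omega)
    have h2 := h x hx (by omega)
    rw [mem_union] at h2
    rw [pre_succ, pre_succ]
    split_ifs <;> first | omega | tauto

lemma pre_add_pre_eq (A B : Finset ℕ) (m : ℕ) :
    pre A m + pre B m = pre (A ∪ B) m + pre (A ∩ B) m := by
  unfold pre
  rw [← card_union_add_card_inter (A ∩ range m) (B ∩ range m), union_inter_distrib_right]
  congr 2
  ext x
  simp only [mem_inter]
  tauto

/-- In cross `t`-intersecting families of which one is shifted, any two members have, after some
common number `m` of steps, at least `m + t` elements together.  Otherwise the largest common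
element could be moved to the largest gap of `A ∪ B` below it, again and again, until fewer than
`t` common elements are left. -/
lemma exists_add_le_pre_add_pre {t : ℕ} {𝒜 ℬ : Finset (Finset ℕ)} (hs : LeftClosed 𝒜)
    (hc : Cross t 𝒜 ℬ) {A B : Finset ℕ} (hA : A ∈ 𝒜) (hB : B ∈ ℬ) :
    ∃ m, m + t ≤ pre A m + pre B m := by
  by_contra! hcon
  induction hd : (A ∩ B).card generalizing A with
  | zero =>
    have := hc A hA B hB
    have := hcon 0
    simp at this
    omega
  | succ d ih =>
    have ht := hc A hA B hB
    have hne : (A ∩ B).Nonempty := card_pos.1 (by omega)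
    set x := (A ∩ B).max' hne with hx
    have hxm : x ∈ A ∩ B := max'_mem _ _
    have hxle : ∀ z ∈ A ∩ B, z ≤ x := fun z hz => le_max' _ _ hz
    have hxA := (mem_inter.1 hxm).1
    have hxB := (mem_inter.1 hxm).2
    have hgap : ((range x).filter (fun z => z ∉ A ∪ B)).Nonempty := by
      rw [filter_nonempty_iff]
      by_contra! hno
      have h1 := pre_add_pre_eq A B (x + 1)
      have h2 : pre (A ∪ B) (x + 1) = x + 1 := by
        unfold pre
        rw [inter_eq_right.2, card_range]
        intro z hz
        rw [mem_range] at hz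
        rcases eq_or_ne z x with rfl | hzx
        · exact mem_union_left _ hxA
        · exact hno z (mem_range.2 (by omega))
      have h3 : pre (A ∩ B) (x + 1) = (A ∩ B).card :=
        pre_eq_card (n := x + 1)
          (fun z hz => mem_range.2 (Nat.lt_succ_of_le (hxle z hz))) le_rfl
      have := hcon (x + 1)
      omega
    set y := ((range x).filter (fun z => z ∉ A ∪ B)).max' hgap with hy
    have hym := max'_mem _ hgap
    rw [← hy, mem_filter, mem_range, mem_union, not_or] at hym
    obtain ⟨hyx, hyA, hyB⟩ := hym
    have hyle : ∀ z, y < z → z < x → z ∈ A ∪ B := by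
      intro z hz hzx
      by_contra hzu
      have := le_max' ((range x).filter (fun z => z ∉ A ∪ B)) z
        (mem_filter.2 ⟨mem_range.2 hzx, hzu⟩)
      omega
    refine ih (hs A hA y x hyx hxA hyA) ?_ ?_
    · intro m
      rw [pre_replace hyx hxA hyA]
      split_ifs with hm
      · have h1 := pre_add_pre_of_forall_mem_union (A := A) (B := B) hm.2
          (fun z hz hz' => hyle z (by omega) hz')
        have h2 := hcon (x + 1)
        rw [pre_succ, pre_succ, if_pos hxA, if_pos hxB] at h2
        omega
      · have := hcon m
        omega
    · have : insert y (A.erase x) ∩ B = (A ∩ B).erase x := by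
        rw [insert_inter_of_notMem hyB, erase_inter]
      rw [this, card_erase_of_mem hxm, hd, Nat.add_sub_cancel]

/-! ### Counting walks -/

/-- The binomial coefficient `n.choose (k - u)` for integer subtraction: it is `0` for `k < u`. -/
def reflBinom (n k u : ℕ) : ℕ := if u ≤ k then n.choose (k - u) else 0

lemma reflBinom_le (n k u : ℕ) : reflBinom n k u ≤ n.choose (k - u) := by
  unfold reflBinom; split_ifs <;> simp

lemma reflBinom_of_le {n k u : ℕ} (h : u ≤ k) : reflBinom n k u = n.choose (k - u) := if_pos h

lemma reflBinom_succ_zero (n u : ℕ) : reflBinom (n + 1) 0 u = reflBinom n 0 u := by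
  unfold reflBinom; split_ifs <;> simp

lemma reflBinom_succ_succ (n k u : ℕ) :
    reflBinom (n + 1) (k + 1) u = reflBinom n (k + 1) u + reflBinom n k u := by
  unfold reflBinom
  rcases lt_trichotomy u (k + 1) with h | rfl | h
  · rw [if_pos (by omega), if_pos (by omega), if_pos (by omega),
      show k + 1 - u = k - u + 1 by omega, Nat.choose_succ_succ', add_comm]
  · simp
  · rw [if_neg (by omega), if_neg (by omega), if_neg (by omega)]

lemma choose_eq_reflBinom {n k u : ℕ} (h : 2 * k = n + u) : n.choose k = reflBinom n k u := by
  unfold reflBinom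
  split_ifs with h'
  · exact Nat.choose_symm_of_eq_add (by omega)
  · exact Nat.choose_eq_zero_of_lt (by omega)

lemma card_filter_powersetCard_succ (n k : ℕ) (Q : Finset ℕ → Prop) [DecidablePred Q] :
    ((powersetCard (k + 1) (range (n + 1))).filter Q).card =
      ((powersetCard (k + 1) (range n)).filter Q).card +
        ((powersetCard k (range n)).filter (fun F => Q (insert n F))).card := by
  have hn : n ∉ range n := by simp
  rw [range_add_one, powersetCard_succ_insert hn, filter_union, card_union_of_disjoint,
    filter_image, card_image_of_injOn]
  · intro F hF G hG h
    have hF' : n ∉ F := fun h' => hn ((mem_powersetCard.1 (mem_filter.1 hF).1).1 h')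
    have hG' : n ∉ G := fun h' => hn ((mem_powersetCard.1 (mem_filter.1 hG).1).1 h')
    have := congrArg (fun s => s.erase n) h
    simpa [erase_insert hF', erase_insert hG'] using this
  · rw [disjoint_left]
    intro F hF hF'
    obtain ⟨G, -, rfl⟩ := mem_image.1 (mem_filter.1 hF').1
    exact hn ((mem_powersetCard.1 (mem_filter.1 hF).1).1 (mem_insert_self _ _))

/-- For a set `F` of integers below `n`, adding `n` affects the walk only after `n + 1` steps. -/
lemma le_pre_insert_iff {n m u : ℕ} {F : Finset ℕ} (hF : F ⊆ range n) :
    m + u ≤ 2 * pre (insert n F) m ↔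
      (m ≤ n ∧ m + u ≤ 2 * pre F m) ∨ (n < m ∧ m + u ≤ 2 * (F.card + 1)) := by
  rcases le_or_gt m n with h | h
  · rw [pre_insert_of_le h]; omega
  · have hn : n ∉ F := fun h' => by simpa using hF h'
    rw [pre_eq_card (n := n + 1) _ h, card_insert_of_notMem hn]
    · omega
    · intro x hx
      rcases mem_insert.1 hx with rfl | hx
      · simp
      · have := mem_range.1 (hF hx); simp; omega

lemma hits_insert_iff {n u : ℕ} {F : Finset ℕ} (hF : F ⊆ range n) :
    Hits u (insert n F) ↔ Hits u F ∨ n + 1 + u ≤ 2 * (F.card + 1) := by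
  unfold Hits
  simp only [le_pre_insert_iff hF]
  constructor
  · rintro ⟨m, h | h⟩
    · exact Or.inl ⟨m, h.2⟩
    · exact Or.inr (by omega)
  · rintro (⟨m, h⟩ | h)
    · rcases le_or_gt m n with hm | hm
      · exact ⟨m, Or.inl ⟨hm, h⟩⟩
      · refine ⟨n, Or.inl ⟨le_rfl, ?_⟩⟩
        rw [pre_eq_card hF hm.le] at h
        rw [pre_eq_card hF le_rfl]; omega
    · exact ⟨n + 1, Or.inr ⟨by omega, h⟩⟩

lemma hitsTwice_insert_iff {n u : ℕ} {F : Finset ℕ} (hF : F ⊆ range n)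
    (hk : 2 * (F.card + 1) ≤ n + 1 + u) :
    HitsTwice u (insert n F) ↔
      HitsTwice u F ∨ (n + 1 + u = 2 * (F.card + 1) ∧ Hits u F) := by
  unfold HitsTwice
  simp only [le_pre_insert_iff hF]
  constructor
  · rintro ⟨m, m', hmm, h | h, h' | h'⟩
    · exact Or.inl ⟨m, m', hmm, h.2, h'.2⟩
    · exact Or.inr ⟨by omega, m, h.2⟩
    · omega
    · omega
  · have key : ∀ m, m + u ≤ 2 * pre F m → m ≤ n := by
      intro m hm
      by_contra! h
      rw [pre_eq_card hF h.le] at hm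
      omega
    rintro (⟨m, m', hmm, h, h'⟩ | ⟨he, m, h⟩)
    · exact ⟨m, m', hmm, Or.inl ⟨key m h, h⟩, Or.inl ⟨key m' h', h'⟩⟩
    · have := key m h
      exact ⟨m, n + 1, by omega, Or.inl ⟨this, h⟩, Or.inr ⟨by omega, by omega⟩⟩

open scoped Classical in
/-- The reflection principle, proved by removing the last step of the walk. -/
lemma card_filter_hits {n k u : ℕ} (h : 2 * k ≤ n + u) :
    ((powersetCard k (range n)).filter (Hits u)).card = reflBinom n k u := by
  induction n generalizing k with
  | zero =>
    rcases k with _ | k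
    · have : Hits u ∅ ↔ u = 0 := by
        constructor
        · intro h; simpa using h.le_card
        · rintro rfl; exact hits_zero _
      by_cases hu : u = 0
      · subst hu
        simp [hits_zero, reflBinom]
      · simp [filter_singleton, this, hu, reflBinom]
    · rw [reflBinom, if_neg (by omega), powersetCard_eq_empty.2 (by simp)]; simp
  | succ n ih =>
    rcases k with _ | k
    · rw [reflBinom_succ_zero, ← ih (by omega)]; simp
    rw [card_filter_powersetCard_succ]
    rcases Nat.lt_or_eq_of_le h with h' | h'
    · rw [reflBinom_succ_succ, ← ih (by omega), ← ih (by omega)]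
      congr 2
      apply filter_congr
      intro F hF
      rw [mem_powersetCard] at hF
      rw [hits_insert_iff hF.1, hF.2]
      constructor
      · rintro (h | h); exacts [h, by omega]
      · exact Or.inl
    · rw [← choose_eq_reflBinom h', filter_true_of_mem, filter_true_of_mem, card_powersetCard,
        card_powersetCard, card_range, add_comm, Nat.choose_succ_succ']
      · intro F hF
        rw [mem_powersetCard] at hF
        rw [hits_insert_iff hF.1, hF.2]
        exact Or.inr h'.ge
      · intro F hF
        rw [mem_powersetCard] at hF
        exact ⟨n, by rw [pre_eq_card hF.1 le_rfl]; omega⟩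

open scoped Classical in
/-- Exchanging the two kinds of steps between the first two visits to the line `y = x + u` turns a
walk that touches this line twice without crossing it into one that crosses it.  So at most half
of the walks counted here do not cross the line.  The formal proof removes the last step instead. -/
lemma card_filter_hitsTwice_le {n k u : ℕ} (h : 2 * k ≤ n + u) :
    ((powersetCard k (range n)).filter (HitsTwice u)).card ≤ 2 * reflBinom n k (u + 1) := by
  induction n generalizing k with
  | zero =>
    rcases k with _ | k
    · have : ¬ HitsTwice u ∅ := by
        rintro ⟨m, m', hmm, -, h'⟩
        simp [pre] at h'; omega
      simp [filter_singleton, this, reflBinom]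
    · rw [powersetCard_eq_empty.2 (by simp)]; simp
  | succ n ih =>
    rcases k with _ | k
    · rw [reflBinom_succ_zero]; simpa using ih (k := 0) (by omega)
    rw [card_filter_powersetCard_succ, reflBinom_succ_succ, mul_add]
    rcases Nat.lt_or_eq_of_le h with h' | h'
    · refine add_le_add (ih (by omega)) ((card_le_card ?_).trans (ih (k := k) (by omega)))
      intro F hF
      rw [mem_filter, mem_powersetCard] at hF
      rw [mem_filter, mem_powersetCard]
      refine ⟨hF.1, ?_⟩
      have h2 := (hitsTwice_insert_iff hF.1.1 (by omega)).1 hF.2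
      rw [hF.1.2] at h2
      rcases h2 with h2 | h2
      exacts [h2, by omega]
    · have h1 : ((powersetCard (k + 1) (range n)).filter (HitsTwice u)).card ≤
          reflBinom n (k + 1) (u + 1) := by
        refine (card_filter_le _ _).trans ?_
        rw [card_powersetCard, card_range, choose_eq_reflBinom (u := u + 1) (by omega)]
      have h2 : ((powersetCard k (range n)).filter (fun F => HitsTwice u (insert n F))).card ≤
          reflBinom n (k + 1) (u + 1) := by
        have h3 : reflBinom n (k + 1) (u + 1) = reflBinom n k u := by
          simp [reflBinom]
        rw [h3, ← card_filter_hits (by omega : 2 * k ≤ n + u)]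
        refine card_le_card fun F hF => ?_
        rw [mem_filter, mem_powersetCard] at hF
        rw [mem_filter, mem_powersetCard]
        refine ⟨hF.1, ?_⟩
        rcases (hitsTwice_insert_iff hF.1.1 (by omega)).1 hF.2 with ⟨m, -, -, hm, -⟩ | h2
        exacts [⟨m, hm⟩, h2.2]
      omega

/-- The sets with a prescribed initial part: `S` consists of `a`-subsets of `[j]`. -/
lemma card_filter_inter_range_mem {n k j a : ℕ} {S : Finset (Finset ℕ)}
    (hS : S ⊆ powersetCard a (range j)) (hj : j ≤ n) (ha : a ≤ k) :
    ((powersetCard k (range n)).filter (fun F => F ∩ range j ∈ S)).card =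
      S.card * (n - j).choose (k - a) := by
  have hI : (powersetCard (k - a) (Ico j n)).card = (n - j).choose (k - a) := by
    rw [card_powersetCard, Nat.card_Ico]
  rw [← hI, ← card_product]
  have hdj : ∀ G ∈ powersetCard (k - a) (Ico j n), ∀ x ∈ G, j ≤ x ∧ x < n := fun G hG x hx =>
    mem_Ico.1 ((mem_powersetCard.1 hG).1 hx)
  have hSj : ∀ P ∈ S, ∀ x ∈ P, x < j := fun P hP x hx =>
    mem_range.1 ((mem_powersetCard.1 (hS hP)).1 hx)
  refine card_nbij' (fun F => (F ∩ range j, F \ range j)) (fun p => p.1 ∪ p.2) ?_ ?_ ?_ ?_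
  · intro F hF
    simp only [mem_coe, mem_filter, mem_powersetCard] at hF
    have h1 := (mem_powersetCard.1 (hS hF.2)).2
    have h2 := card_sdiff_add_card_inter F (range j)
    simp only [coe_product, Set.mem_prod, mem_coe, mem_powersetCard]
    refine ⟨hF.2, ?_, by omega⟩
    intro x hx
    rw [mem_sdiff, mem_range] at hx
    exact mem_Ico.2 ⟨by omega, mem_range.1 (hF.1.1 hx.1)⟩
  · rintro ⟨P, G⟩ hp
    simp only [coe_product, Set.mem_prod, mem_coe] at hp
    have h1 : (P ∪ G) ∩ range j = P := by
      ext x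
      have := hdj G hp.2 x
      have := hSj P hp.1 x
      simp only [mem_inter, mem_union, mem_range]
      grind
    have h2 : Disjoint P G := by
      rw [disjoint_left]; intro x hx hx'
      have := hdj G hp.2 x hx'
      have := hSj P hp.1 x hx
      omega
    simp only [mem_coe, mem_filter, mem_powersetCard, h1]
    refine ⟨⟨?_, ?_⟩, hp.1⟩
    · intro x hx
      rw [mem_range]
      rcases mem_union.1 hx with hx | hx
      · have := hSj P hp.1 x hx; omega
      · exact (hdj G hp.2 x hx).2
    · rw [card_union_of_disjoint h2, (mem_powersetCard.1 (hS hp.1)).2,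
        (mem_powersetCard.1 hp.2).2]
      omega
  · intro F hF
    ext x
    simp only [mem_union, mem_inter, mem_sdiff]
    tauto
  · rintro ⟨P, G⟩ hp
    simp only [coe_product, Set.mem_prod, mem_coe] at hp
    ext x
    · have := hdj G hp.2 x
      have := hSj P hp.1 x
      simp only [mem_inter, mem_union, mem_range]
      grind
    · have := hdj G hp.2 x
      have := hSj P hp.1 x
      simp only [mem_sdiff, mem_union, mem_range]
      grind

/-- The number of walks with `u + i` up and `i` right steps that do not cross the line
`y = x + u`. -/
def ballot (u i : ℕ) : ℕ := (u + 2 * i).choose i - if i = 0 then 0 else (u + 2 * i).choose (i - 1)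

open scoped Classical in
lemma card_filter_not_hits_range (u i : ℕ) :
    ((powersetCard (u + i) (range (u + 2 * i))).filter (fun F => ¬ Hits (u + 1) F)).card =
      ballot u i := by
  have h1 := card_filter_add_card_filter_not (s := powersetCard (u + i) (range (u + 2 * i)))
    (Hits (u + 1))
  rw [card_filter_hits (by omega), card_powersetCard, card_range,
    Nat.choose_symm_of_eq_add (show u + 2 * i = u + i + i by omega)] at h1
  unfold ballot
  rcases i with _ | i
  · simp [reflBinom] at h1 ⊢; exact h1
  · rw [reflBinom_of_le (by omega), show u + (i + 1) - (u + 1) = i by omega] at h1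
    simp only [Nat.add_eq_zero_iff, one_ne_zero, and_false, if_false, Nat.add_sub_cancel]
    omega

open scoped Classical in
/-- The walks through the point `(i, u + i)` of the line `y = x + u` that never cross it. -/
lemma card_filter_touch_le {n k u i : ℕ} (hj : u + 2 * i ≤ n) (hk : u + i ≤ k) :
    ((powersetCard k (range n)).filter
        (fun F => 2 * pre F (u + 2 * i) = u + 2 * i + u ∧ ¬ Hits (u + 1) F)).card ≤
      ballot u i * (n - (u + 2 * i)).choose (k - (u + i)) := by
  rw [← card_filter_not_hits_range, ← card_filter_inter_range_mem (filter_subset _ _) hj hk]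
  refine card_le_card fun F hF => ?_
  rw [mem_filter] at hF ⊢
  refine ⟨hF.1, mem_filter.2 ⟨mem_powersetCard.2 ⟨inter_subset_right, ?_⟩, ?_⟩⟩
  · change pre F (u + 2 * i) = _
    omega
  · rintro ⟨m, hm⟩
    refine hF.2.2 ⟨m, hm.trans ?_⟩
    have : pre (F ∩ range (u + 2 * i)) m ≤ pre F m :=
      card_le_card (inter_subset_inter_right inter_subset_left)
    omega

open scoped Classical in
/-- The sets with initial part in `S`, no further element below `j`, and such that the
walk never makes a net gain after `j` steps. -/
lemma card_mul_le_card_stalling {n k j j₀ a : ℕ} {S : Finset (Finset ℕ)}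
    (hS : S ⊆ powersetCard a (range j₀)) (hj₀ : j₀ ≤ j) (hj : j ≤ n) (ha : a ≤ k)
    (hk : 2 * (k - a) ≤ n - j + 1) :
    S.card * ((n - j).choose (k - a) - reflBinom (n - j) (k - a) 1) ≤
      ((powersetCard k (range n)).filter
        (fun F => F ∩ range j ∈ S ∧ ∀ m, j ≤ m → 2 * pre F m + j ≤ m + 2 * a)).card := by
  set 𝒢 := (powersetCard (k - a) (range (n - j))).filter (fun F => ¬ Hits 1 F) with h𝒢
  have hcard : 𝒢.card = (n - j).choose (k - a) - reflBinom (n - j) (k - a) 1 := by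
    have h1 : ((powersetCard (k - a) (range (n - j))).filter (Hits 1)).card + 𝒢.card = _ :=
      card_filter_add_card_filter_not _
    rw [card_filter_hits hk, card_powersetCard, card_range] at h1
    omega
  rw [← hcard, ← card_product]
  let e : ℕ ↪ ℕ := addRightEmbedding j
  have hem : ∀ (G : Finset ℕ) x, x ∈ G.map e ↔ j ≤ x ∧ x - j ∈ G := by
    intro G x
    simp only [mem_map, e, addRightEmbedding_apply]
    constructor
    · rintro ⟨y, hy, rfl⟩; simpa using hy
    · rintro ⟨h, h'⟩; exact ⟨x - j, h', by omega⟩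
  have hSj : ∀ P ∈ S, ∀ x ∈ P, x < j := fun P hP x hx =>
    (mem_range.1 ((mem_powersetCard.1 (hS hP)).1 hx)).trans_le hj₀
  have hinter : ∀ P ∈ S, ∀ G : Finset ℕ, (P ∪ G.map e) ∩ range j = P := by
    intro P hP G
    ext x
    have := hSj P hP x
    simp only [mem_inter, mem_union, mem_range, hem]
    grind
  have hdisj : ∀ P ∈ S, ∀ G : Finset ℕ, Disjoint P (G.map e) := by
    intro P hP G
    rw [disjoint_left]
    intro x hx hx'
    have := hSj P hP x hx
    have := ((hem G x).1 hx').1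
    omega
  refine card_le_card_of_injOn (fun p => p.1 ∪ p.2.map e) ?_ ?_
  · rintro ⟨P, G⟩ hp
    simp only [coe_product, Set.mem_prod, mem_coe, h𝒢, mem_filter, mem_powersetCard] at hp
    obtain ⟨hP, ⟨hGn, hGk⟩, hG⟩ := hp
    have hPa := (mem_powersetCard.1 (hS hP)).2
    simp only [mem_coe, mem_filter, mem_powersetCard, hinter P hP G]
    refine ⟨⟨?_, ?_⟩, hP, ?_⟩
    · intro x hx
      rw [mem_range]
      rcases mem_union.1 hx with hx | hx
      · have := hSj P hP x hx; omega
      · have := (hem G x).1 hx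
        have := mem_range.1 (hGn this.2)
        omega
    · rw [card_union_of_disjoint (hdisj P hP G), card_map]; omega
    · intro m hm
      have h1 : pre (P ∪ G.map e) m = a + pre G (m - j) := by
        unfold pre
        have : (P ∪ G.map e) ∩ range m = P ∪ (G ∩ range (m - j)).map e := by
          ext x
          have := hSj P hP x
          simp only [mem_inter, mem_union, mem_range, hem]
          grind
        rw [this, card_union_of_disjoint (hdisj P hP _), card_map, hPa]
      have h2 := two_mul_pre_le_of_not_hits hG (m - j)
      rw [h1]
      omega
  · rintro ⟨P, G⟩ hp ⟨P', G'⟩ hp' h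
    simp only [coe_product, Set.mem_prod, mem_coe] at hp hp'
    simp only at h
    have h1 : P = P' := by
      rw [← hinter P hp.1 G, h, hinter P' hp'.1 G']
    subst h1
    have h2 : G.map e = G'.map e := by
      have := congrArg (· \ P) h
      simpa [union_sdiff_cancel_left (hdisj P hp.1 _)] using this
    rw [map_inj.1 h2]

/-! ### Estimates for binomial coefficients -/

lemma mul_choose_sub_one_le {t N m : ℕ} (hm : 1 ≤ m) (h : (t + 1) * m ≤ N + 1) :
    t * N.choose (m - 1) ≤ N.choose m := by
  obtain ⟨m, rfl⟩ : ∃ m', m = m' + 1 := ⟨m - 1, by omega⟩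
  have h1 := Nat.choose_succ_right_eq N m
  have h2 : t * (m + 1) ≤ N - m := by
    have : t * (m + 1) + m + 1 ≤ N + 1 := by linarith
    omega
  refine Nat.le_of_mul_le_mul_right (c := m + 1) ?_ (Nat.succ_pos _)
  rw [h1, Nat.add_sub_cancel]
  calc t * N.choose m * (m + 1) = N.choose m * (t * (m + 1)) := by ring
    _ ≤ _ := Nat.mul_le_mul_left _ h2

lemma pow_mul_choose_sub_le {t N m : ℕ} (l : ℕ) (hl : l ≤ m) (h : (t + 1) * m ≤ N + 1) :
    t ^ l * N.choose (m - l) ≤ N.choose m := by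
  induction l with
  | zero => simp
  | succ l ih =>
    have h1 : t * N.choose (m - l - 1) ≤ N.choose (m - l) :=
      mul_choose_sub_one_le (by omega) ((Nat.mul_le_mul_left _ (Nat.sub_le _ _)).trans h)
    calc t ^ (l + 1) * N.choose (m - (l + 1)) = t ^ l * (t * N.choose (m - l - 1)) := by
          rw [Nat.sub_sub, pow_succ]; ring
      _ ≤ t ^ l * N.choose (m - l) := Nat.mul_le_mul_left _ h1
      _ ≤ _ := ih (by omega)

lemma pow_mul_choose_sub_sub_le {t N m : ℕ} (l : ℕ) (hl : l ≤ m) (h : (t + 1) * m ≤ N) :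
    (t + 1) ^ l * (N - l).choose (m - l) ≤ N.choose m := by
  induction l with
  | zero => simp
  | succ l ih =>
    have hmN : m ≤ N := (Nat.le_mul_of_pos_left m (Nat.succ_pos t)).trans h
    obtain ⟨a, ha⟩ : ∃ a, m - l = a + 1 := ⟨m - l - 1, by omega⟩
    obtain ⟨b, hb⟩ : ∃ b, N - l = b + 1 := ⟨N - l - 1, by omega⟩
    have h2 : (t + 1) * (a + 1) ≤ b + 1 := by
      have h3 : (t + 1) * (a + 1) + (t + 1) * l ≤ N := by
        rw [← mul_add, show a + 1 + l = m by omega]; exact h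
      have h4 : l ≤ (t + 1) * l := Nat.le_mul_of_pos_left l (Nat.succ_pos t)
      omega
    have h1 : (t + 1) * b.choose a ≤ (b + 1).choose (a + 1) := by
      have h5 := Nat.add_one_mul_choose_eq b a
      refine Nat.le_of_mul_le_mul_right (c := a + 1) ?_ (Nat.succ_pos _)
      rw [← h5]
      calc (t + 1) * b.choose a * (a + 1) = (t + 1) * (a + 1) * b.choose a := by ring
        _ ≤ _ := Nat.mul_le_mul_right _ h2
    calc (t + 1) ^ (l + 1) * (N - (l + 1)).choose (m - (l + 1))
        = (t + 1) ^ l * ((t + 1) * b.choose a) := by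
          rw [show N - (l + 1) = b by omega, show m - (l + 1) = a by omega, pow_succ]; ring
      _ ≤ (t + 1) ^ l * (N - l).choose (m - l) := by
          rw [ha, hb]; exact Nat.mul_le_mul_left _ h1
      _ ≤ _ := ih (by omega)

lemma pow_mul_choose_add_le {t N m : ℕ} (d : ℕ) (h : (t + 1) * m ≤ N + 1) :
    t ^ d * (N + d).choose m ≤ (t + 1) ^ d * N.choose m := by
  induction d with
  | zero => simp
  | succ d ih =>
    have h1 := Nat.choose_mul_succ_eq (N + d) m
    have hmN : m ≤ N + 1 := (Nat.le_mul_of_pos_left m (Nat.succ_pos t)).trans h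
    have h2 : t * (N + d + 1) ≤ (t + 1) * (N + d + 1 - m) := by
      rw [Nat.mul_sub]
      have : t * (N + d + 1) + (N + d + 1) = (t + 1) * (N + d + 1) := by ring
      omega
    have h3 : t * (N + d + 1).choose m ≤ (t + 1) * (N + d).choose m := by
      refine Nat.le_of_mul_le_mul_right (c := N + d + 1) ?_ (Nat.succ_pos _)
      calc t * (N + d + 1).choose m * (N + d + 1)
          = (N + d + 1).choose m * (t * (N + d + 1)) := by ring
        _ ≤ (N + d + 1).choose m * ((t + 1) * (N + d + 1 - m)) := Nat.mul_le_mul_left _ h2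
        _ = (t + 1) * ((N + d + 1).choose m * (N + d + 1 - m)) := by ring
        _ = (t + 1) * (N + d).choose m * (N + d + 1) := by rw [← h1]; ring
    calc t ^ (d + 1) * (N + (d + 1)).choose m = t ^ d * (t * (N + d + 1).choose m) := by
          rw [pow_succ, ← add_assoc]; ring
      _ ≤ t ^ d * ((t + 1) * (N + d).choose m) := Nat.mul_le_mul_left _ h3
      _ = (t + 1) * (t ^ d * (N + d).choose m) := by ring
      _ ≤ (t + 1) * ((t + 1) ^ d * N.choose m) := Nat.mul_le_mul_left _ ih
      _ = _ := by rw [pow_succ]; ring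

lemma choose_sub_mul_choose_add_le {n a b : ℕ} (s : ℕ) (hs : s ≤ a) (hab : a ≤ b) :
    n.choose (a - s) * n.choose (b + s) ≤ n.choose a * n.choose b := by
  induction s with
  | zero => simp
  | succ s ih =>
    refine le_trans ?_ (ih (by omega))
    obtain ⟨a', ha'⟩ : ∃ a', a - s = a' + 1 := ⟨a - s - 1, by omega⟩
    rw [show a - (s + 1) = a' by omega, ha', ← add_assoc]
    set c := b + s with hc
    have hac : a' + 1 ≤ c := by omega
    rcases Nat.lt_or_ge n (c + 1) with hn | hn
    · rw [Nat.choose_eq_zero_of_lt hn]; simp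
    have h1 := Nat.choose_succ_right_eq n a'
    have h2 := Nat.choose_succ_right_eq n c
    have h3 : (a' + 1) * (n - c) ≤ (n - a') * (c + 1) := by
      rw [mul_comm]; exact Nat.mul_le_mul (by omega) (by omega)
    have hpos : 0 < (n - a') * (c + 1) := Nat.mul_pos (by omega) (by omega)
    refine Nat.le_of_mul_le_mul_right (c := (n - a') * (c + 1)) ?_ hpos
    calc n.choose a' * n.choose (c + 1) * ((n - a') * (c + 1))
        = (n.choose a' * (n - a')) * (n.choose (c + 1) * (c + 1)) := by ring
      _ = (n.choose (a' + 1) * n.choose c) * ((a' + 1) * (n - c)) := by rw [← h1, h2]; ring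
      _ ≤ _ := Nat.mul_le_mul_left _ h3

/-- The mixed products of the two families decrease with the imbalance `s`, as soon as `K > t`. -/
lemma choose_sub_sub_mul_choose_add_le {n t K : ℕ} (s : ℕ) (hs : s ≤ K) (hK : t + 1 ≤ K)
    (hn : t + K ≤ n) :
    (n - t - s).choose (K - s) * n.choose (K - 1 + s) ≤ (n - t).choose K * n.choose (K - 1) := by
  induction s with
  | zero => simp
  | succ s ih =>
    refine le_trans ?_ (ih (by omega))
    obtain ⟨a, ha⟩ : ∃ a, K - s = a + 1 := ⟨K - s - 1, by omega⟩
    obtain ⟨b, hb⟩ : ∃ b, n - t - s = b + 1 := ⟨n - t - s - 1, by omega⟩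
    rw [show n - t - (s + 1) = b by omega, show K - (s + 1) = a by omega, ha, hb, ← add_assoc]
    set c := K - 1 + s with hc
    have h1 := Nat.add_one_mul_choose_eq b a
    have h2 := Nat.choose_succ_right_eq n c
    have h3 : (a + 1) * (n - c) ≤ (b + 1) * (c + 1) := by
      rw [mul_comm]
      exact Nat.mul_le_mul (by omega) (by omega)
    refine Nat.le_of_mul_le_mul_right (c := (b + 1) * (c + 1)) ?_
      (Nat.mul_pos (Nat.succ_pos _) (Nat.succ_pos _))
    calc b.choose a * n.choose (c + 1) * ((b + 1) * (c + 1))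
        = ((b + 1) * b.choose a) * (n.choose (c + 1) * (c + 1)) := by ring
      _ = ((b + 1).choose (a + 1) * n.choose c) * ((a + 1) * (n - c)) := by rw [h1, h2]; ring
      _ ≤ _ := Nat.mul_le_mul_left _ h3

/-! ### Numerical inequalities in `t` -/

lemma one_add_inv_pow_le_exp {t : ℕ} (ht : 0 < t) : (1 + 1 / (t : ℝ)) ^ t ≤ Real.exp 1 := by
  have h1 : 1 + 1 / (t : ℝ) ≤ Real.exp (1 / t) := by
    have := Real.add_one_le_exp (1 / (t : ℝ)); linarith
  calc (1 + 1 / (t : ℝ)) ^ t ≤ Real.exp (1 / t) ^ t := by gcongr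
    _ = Real.exp 1 := by
      rw [← Real.exp_nat_mul]; congr 1; field_simp

lemma one_add_inv_pow_lt {t : ℕ} (ht : 0 < t) : (1 + 1 / (t : ℝ)) ^ t < 2.7182818286 :=
  (one_add_inv_pow_le_exp ht).trans_lt Real.exp_one_lt_d9

/-- The inequality that makes `14` the threshold: `2 (1 + 1 / t) ^ (2 t) < t`. -/
lemma two_mul_one_add_inv_pow_sq_lt {t : ℕ} (ht : 14 ≤ t) :
    2 * ((1 + 1 / (t : ℝ)) ^ t) ^ 2 < t := by
  rcases eq_or_lt_of_le ht with rfl | h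
  · norm_num
  · have h1 := one_add_inv_pow_lt (t := t) (by omega)
    have h0 : 0 ≤ (1 + 1 / (t : ℝ)) ^ t := by positivity
    have h2 : (15 : ℝ) ≤ t := by exact_mod_cast h
    nlinarith

lemma one_add_inv_pow_div_lt {t : ℕ} (ht : 14 ≤ t) : (1 + 1 / (t : ℝ)) ^ t / t < 0.1942 := by
  have h1 := one_add_inv_pow_lt (t := t) (by omega)
  have h2 : (14 : ℝ) ≤ t := by exact_mod_cast ht
  rw [div_lt_iff₀ (by linarith)]
  nlinarith

/-- What is gained by leaving the extremal structure at level `l` is less than what is lost. -/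
lemma gain_lt_loss {t : ℕ} (ht : 14 ≤ t) {l : ℕ} (hl : 1 ≤ l) :
    (1 + 1 / (t : ℝ)) ^ (t + 3) < t ^ l * (((t - 1 : ℝ) / t) ^ (l + 1) * ((t - 2) / (t - 1))) := by
  have h2 : (14 : ℝ) ≤ t := by exact_mod_cast ht
  have h1 := one_add_inv_pow_lt (t := t) (by omega)
  have hq : (13 / 14 : ℝ) ≤ (t - 1 : ℝ) / t := by
    rw [le_div_iff₀ (by linarith)]; linarith
  have hr : (12 / 13 : ℝ) ≤ (t - 2 : ℝ) / (t - 1) := by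
    rw [le_div_iff₀ (by linarith)]; linarith
  have hA : (1 + 1 / (t : ℝ)) ^ (t + 3) < 4 := by
    have h3 : 1 + 1 / (t : ℝ) ≤ 15 / 14 := by
      have : 1 / (t : ℝ) ≤ 1 / 14 := by gcongr
      linarith
    have h4 : (1 + 1 / (t : ℝ)) ^ 3 ≤ (15 / 14) ^ 3 := by gcongr
    have h5 : 0 ≤ (1 + 1 / (t : ℝ)) ^ t := by positivity
    rw [pow_add]
    calc (1 + 1 / (t : ℝ)) ^ t * (1 + 1 / (t : ℝ)) ^ 3
        ≤ 2.7182818286 * (15 / 14) ^ 3 := by gcongr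
      _ < 4 := by norm_num
  have hB : (4 : ℝ) < t ^ l * ((13 / 14) ^ (l + 1) * (12 / 13)) := by
    have h6 : ((13 : ℝ)) ^ l ≤ (t : ℝ) ^ l * (13 / 14) ^ l := by
      rw [← mul_pow]; gcongr; linarith
    have h7 : (13 : ℝ) ^ 1 ≤ 13 ^ l := pow_le_pow_right₀ (by norm_num) hl
    rw [pow_succ]
    linarith
  have hC : (t : ℝ) ^ l * ((13 / 14) ^ (l + 1) * (12 / 13)) ≤
      t ^ l * (((t - 1 : ℝ) / t) ^ (l + 1) * ((t - 2) / (t - 1))) := by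
    have : (0 : ℝ) ≤ (t - 1) / t := le_trans (by norm_num) hq
    gcongr
  linarith

lemma add_mul_ballot (u i : ℕ) : (u + i + 1) * (ballot u i : ℝ) = (u + 1) * (u + 2 * i).choose i := by
  unfold ballot
  rcases i with _ | i
  · simp
  · have h1 := Nat.choose_succ_right_eq (u + 2 * (i + 1)) i
    rw [show u + 2 * (i + 1) - i = u + i + 2 by omega] at h1
    have h2 : (u + 2 * (i + 1)).choose i ≤ (u + 2 * (i + 1)).choose (i + 1) := by
      refine Nat.le_of_mul_le_mul_right (c := i + 1) ?_ (Nat.succ_pos _)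
      rw [h1]
      exact Nat.mul_le_mul_left _ (by omega)
    have h3 : ((u + 2 * (i + 1)).choose (i + 1) : ℝ) * (i + 1) =
        (u + 2 * (i + 1)).choose i * (u + i + 2) := by exact_mod_cast h1
    simp only [Nat.add_eq_zero_iff, one_ne_zero, and_false, if_false, Nat.add_sub_cancel]
    rw [Nat.cast_sub h2]
    push_cast
    linarith

lemma ballot_zero (u : ℕ) : ballot u 0 = 1 := by simp [ballot]

lemma ballot_one (u : ℕ) : (ballot u 1 : ℝ) = u + 1 := by
  have h := add_mul_ballot u 1
  rw [Nat.choose_one_right] at h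
  push_cast at h
  have : (0 : ℝ) < u + 1 + 1 := by positivity
  nlinarith

lemma ballot_recurrence (u m : ℕ) :
    (m + 1) * (u + m + 2) * (ballot u (m + 1) : ℝ) =
      (u + 2 * m + 2) * (u + 2 * m + 1) * ballot u m := by
  have h1 := add_mul_ballot u (m + 1)
  have h2 := add_mul_ballot u m
  have h3 : ((u + 2 * m + 2 : ℝ)) * (u + 2 * m + 1).choose m =
      (u + 2 * (m + 1)).choose (m + 1) * (m + 1) := by
    have := Nat.add_one_mul_choose_eq (u + 2 * m + 1) m
    rw [show u + 2 * (m + 1) = u + 2 * m + 1 + 1 by ring]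
    exact_mod_cast this
  have h4 : ((u + 2 * m).choose m : ℝ) * (u + 2 * m + 1) =
      (u + 2 * m + 1).choose m * (u + m + 1) := by
    have := Nat.choose_mul_succ_eq (u + 2 * m) m
    rw [show u + 2 * m + 1 - m = u + m + 1 by omega] at this
    exact_mod_cast this
  push_cast at h1
  have h5 : (0 : ℝ) < u + m + 1 := by positivity
  refine mul_left_cancel₀ h5.ne' ?_
  calc (u + m + 1 : ℝ) * ((m + 1) * (u + m + 2) * ballot u (m + 1))
      = (u + m + 1) * (m + 1) * ((u + (m + 1) + 1) * ballot u (m + 1)) := by ring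
    _ = (u + 1) * (u + m + 1) * ((u + 2 * (m + 1)).choose (m + 1) * (m + 1)) := by rw [h1]; ring
    _ = (u + 1) * (u + 2 * m + 2) * ((u + 2 * m + 1).choose m * (u + m + 1)) := by
        rw [← h3]; ring
    _ = (u + 2 * m + 2) * (u + 2 * m + 1) * ((u + 1) * (u + 2 * m).choose m) := by
        rw [← h4]; ring
    _ = _ := by rw [← h2]; ring

lemma ballot_two (u : ℕ) : (ballot u 2 : ℝ) = (u + 1) * (u + 4) / 2 := by
  have h := ballot_recurrence u 1
  rw [ballot_one] at h
  push_cast at h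
  norm_num at h
  have : (0 : ℝ) < u + 3 := by positivity
  refine mul_left_cancel₀ this.ne' ?_
  linarith

/-- The recurrence in the form of a bound for the quotient of consecutive ballot numbers. -/
lemma ballot_succ_le (u m : ℕ) (hm : 1 ≤ m) :
    (m + 1) * (ballot u (m + 1) : ℝ) ≤ (u + 4 * m) * ballot u m := by
  have h := ballot_recurrence u m
  have h1 : (0 : ℝ) < u + m + 2 := by positivity
  have hm' : (1 : ℝ) ≤ m := by exact_mod_cast hm
  refine le_of_mul_le_mul_left ?_ h1
  calc (u + m + 2 : ℝ) * ((m + 1) * ballot u (m + 1))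
      = (u + 2 * m + 2) * (u + 2 * m + 1) * ballot u m := by rw [← h]; ring
    _ ≤ (u + m + 2) * (u + 4 * m) * ballot u m := by
        gcongr ?_ * _
        have : (0 : ℝ) ≤ (m - 1) * u := mul_nonneg (by linarith) (by positivity)
        nlinarith
    _ = _ := by ring

/-- Relative to `(t + 1) ^ i` the ballot numbers reach their maximum near `i = 2`. -/
lemma ballot_le_of_le_two_mul {t u : ℕ} (ht : 14 ≤ t) (hu : u ≤ 2 * t) (i : ℕ) :
    (ballot u i : ℝ) ≤ 2.14 * (t + 1) ^ i := by
  have h2 : (14 : ℝ) ≤ t := by exact_mod_cast ht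
  have hu' : (u : ℝ) ≤ 2 * t := by exact_mod_cast hu
  have hu0 : (0 : ℝ) ≤ u := by positivity
  have base : (ballot u 2 : ℝ) ≤ 2.14 * (t + 1) ^ 2 := by
    rw [ballot_two]; nlinarith
  rcases Nat.lt_or_ge i 2 with hi | hi
  · interval_cases i
    · rw [ballot_zero]; norm_num
    · rw [ballot_one]; linarith
  · induction i, hi using Nat.le_induction with
    | base => exact base
    | succ m hm ih =>
      have hm' : (2 : ℝ) ≤ m := by exact_mod_cast hm
      have h3 := ballot_succ_le u m (by omega)
      have h4 : (u + 4 * m : ℝ) ≤ (m + 1) * (t + 1) := by nlinarith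
      have h5 : (0 : ℝ) ≤ ballot u m := by positivity
      have h6 : (0 : ℝ) < m + 1 := by positivity
      refine le_of_mul_le_mul_left ?_ h6
      calc (m + 1) * (ballot u (m + 1) : ℝ) ≤ (m + 1) * (t + 1) * ballot u m :=
            h3.trans (by gcongr)
        _ ≤ (m + 1) * (t + 1) * (2.14 * (t + 1) ^ m) := by gcongr
        _ = _ := by ring

lemma ballot_three_le {t w : ℕ} (ht : 14 ≤ t) (hw : w ≤ t) :
    (ballot w 3 : ℝ) ≤ 0.362 * t ^ 3 := by
  have h2 : (14 : ℝ) ≤ t := by exact_mod_cast ht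
  have hw' : (w : ℝ) ≤ t := by exact_mod_cast hw
  have hw0 : (0 : ℝ) ≤ w := by positivity
  have h3 := ballot_succ_le w 2 (by norm_num)
  norm_num at h3
  have h4 : (ballot w 2 : ℝ) ≤ 0.69 * t ^ 2 := by
    rw [ballot_two]; nlinarith
  have h5 : (w + 8 : ℝ) ≤ 1.572 * t := by linarith
  have h6 : (w + 8 : ℝ) * ballot w 2 ≤ 1.572 * t * (0.69 * t ^ 2) := by gcongr
  have h7 : (0 : ℝ) ≤ t ^ 3 := by positivity
  nlinarith

lemma ballot_le_of_four_le {t w m : ℕ} (ht : 14 ≤ t) (hw : w ≤ t) (hm : 4 ≤ m) :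
    (ballot w m : ℝ) ≤ 0.169 * t ^ m := by
  have h2 : (14 : ℝ) ≤ t := by exact_mod_cast ht
  have hw' : (w : ℝ) ≤ t := by exact_mod_cast hw
  induction m, hm using Nat.le_induction with
  | base =>
    have h3 := ballot_succ_le w 3 (by norm_num)
    norm_num at h3
    have h5 : (w + 12 : ℝ) ≤ 1.858 * t := by linarith
    have h4 := ballot_three_le ht hw
    have h6 : (w + 12 : ℝ) * ballot w 3 ≤ 1.858 * t * (0.362 * t ^ 3) := by gcongr
    have h7 : (0 : ℝ) ≤ t ^ 4 := by positivity
    nlinarith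
  | succ m hm ih =>
    have hm' : (4 : ℝ) ≤ m := by exact_mod_cast hm
    have h3 := ballot_succ_le w m (by omega)
    have h4 : (w + 4 * m : ℝ) ≤ (m + 1) * t := by nlinarith
    have h6 : (0 : ℝ) < m + 1 := by positivity
    refine le_of_mul_le_mul_left ?_ h6
    calc (m + 1) * (ballot w (m + 1) : ℝ) ≤ (m + 1) * t * ballot w m :=
          h3.trans (by gcongr)
      _ ≤ (m + 1) * t * (0.169 * t ^ m) := by gcongr
      _ = _ := by ring

/-- The touching points `(i, t + s + i)` and `(i + s, t + i)` are far from being extremal unless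
`i + s ≤ 1`.  The two quotients bound the numbers of walks touching there without crossing,
relative to the main term, and `ε` bounds the walks that cross. -/
lemma add_ballot_mul_add_ballot_lt {t s i : ℕ} (ht : 14 ≤ t) (hs : s ≤ t) (hi : 2 ≤ i + s) {ε : ℝ}
    (hε0 : 0 ≤ ε) (hε : ε < 0.1942) :
    (ε + ballot (t + s) i / (t + 1) ^ i) *
      (ε + ballot (t - s) (i + s) / (t ^ s * (t + 1) ^ i)) < 1 := by
  have h2 : (14 : ℝ) ≤ t := by exact_mod_cast ht
  have ht0 : (0 : ℝ) < t := by linarith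
  set x : ℝ := ballot (t + s) i / (t + 1) ^ i with hx
  set y : ℝ := ballot (t - s) (i + s) / (t ^ s * (t + 1) ^ i) with hy
  have hx0 : 0 ≤ x := by positivity
  have hy0 : 0 ≤ y := by positivity
  have fin : ∀ a b : ℝ, x ≤ a → y ≤ b → (0.1942 + a) * (0.1942 + b) < 1 → (ε + x) * (ε + y) < 1 := by
    intro a b hxa hyb hab
    refine lt_of_le_of_lt ?_ hab
    have : 0 ≤ a := hx0.trans hxa
    gcongr
  have hyb : ∀ c : ℝ, (ballot (t - s) (i + s) : ℝ) ≤ c * t ^ (i + s) → 0 ≤ c → y ≤ c := by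
    intro c hc hc0
    rw [hy, div_le_iff₀ (by positivity)]
    refine hc.trans ?_
    gcongr c * ?_
    rw [pow_add, mul_comm]
    gcongr
    linarith
  rcases Nat.lt_or_ge (i + s) 4 with h4 | h4
  · rcases Nat.lt_or_ge (i + s) 3 with h3 | h3
    · have hi2 : i ≤ 2 := by omega
      interval_cases i
      · obtain rfl : s = 2 := by omega
        refine fin 1 0.54 (by simp [hx, ballot_zero]) ?_ (by norm_num)
        rw [hy, div_le_iff₀ (by positivity), zero_add, ballot_two, Nat.cast_sub hs]
        push_cast
        nlinarith
      · obtain rfl : s = 1 := by omega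
        refine fin 1.067 0.567 ?_ ?_ (by norm_num)
        · rw [hx, ballot_one, div_le_iff₀ (by positivity)]
          push_cast
          linarith
        · rw [hy, div_le_iff₀ (by positivity), ballot_two, Nat.cast_sub hs]
          push_cast
          nlinarith
      · obtain rfl : s = 0 := by omega
        refine fin 0.6 0.6 ?_ ?_ (by norm_num)
        · rw [hx, ballot_two, div_le_iff₀ (by positivity)]
          push_cast
          nlinarith
        · rw [hy, div_le_iff₀ (by positivity), Nat.sub_zero, add_zero, ballot_two]
          nlinarith
    · have h3' : i + s = 3 := by omega
      refine fin 1.14 0.362 ?_ (hyb _ ?_ (by norm_num)) (by norm_num)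
      · have hi3 : i ≤ 3 := by omega
        rw [hx, div_le_iff₀ (by positivity)]
        interval_cases i
        · rw [ballot_zero]; norm_num
        · obtain rfl : s = 2 := by omega
          rw [ballot_one]; push_cast; linarith
        · obtain rfl : s = 1 := by omega
          rw [ballot_two]; push_cast; nlinarith
        · obtain rfl : s = 0 := by omega
          refine (ballot_three_le ht le_rfl).trans ?_
          gcongr
          · norm_num
          · linarith
      · rw [h3']; exact ballot_three_le ht (by omega)
  · refine fin 2.14 0.169 ?_ (hyb _ (ballot_le_of_four_le ht (by omega) h4) (by norm_num))
      (by norm_num)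
    rw [hx, div_le_iff₀ (by positivity)]
    exact ballot_le_of_le_two_mul ht (by omega) i

/-! ### Shifted families: the touching point -/

/-- If `𝒜` has a member touching `y = x + u` exactly once, `ℬ` has one touching `y = x + v`
exactly once, and `u + v = 2 t`, then all members that do not cross the respective line touch it
after one and the same number `j` of steps. -/
lemma exists_common_touch {t u v : ℕ} {𝒜 ℬ : Finset (Finset ℕ)} (hs : LeftClosed 𝒜)
    (hc : Cross t 𝒜 ℬ) (huv : u + v = 2 * t)
    (h𝒜 : ∃ A ∈ 𝒜, ¬ HitsTwice u A) (hℬ : ∃ B ∈ ℬ, ¬ HitsTwice v B) :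
    ∃ j, (∀ A ∈ 𝒜, Hits (u + 1) A ∨ 2 * pre A j = j + u) ∧
      (∀ B ∈ ℬ, Hits (v + 1) B ∨ 2 * pre B j = j + v) ∧
      (∃ A ∈ 𝒜, 2 * pre A j = j + u) ∧ ∃ B ∈ ℬ, 2 * pre B j = j + v := by
  obtain ⟨A₀, hA₀, hA₀'⟩ := h𝒜
  obtain ⟨B₀, hB₀, hB₀'⟩ := hℬ
  have key : ∀ A ∈ 𝒜, ∀ B ∈ ℬ, ¬ Hits (u + 1) A → ¬ Hits (v + 1) B →
      ∃ m, 2 * pre A m = m + u ∧ 2 * pre B m = m + v := by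
    intro A hA B hB hAu hBv
    obtain ⟨m, hm⟩ := exists_add_le_pre_add_pre hs hc hA hB
    have := two_mul_pre_le_of_not_hits hAu m
    have := two_mul_pre_le_of_not_hits hBv m
    exact ⟨m, by omega, by omega⟩
  have hA₀n : ¬ Hits (u + 1) A₀ := fun h => hA₀' h.hitsTwice
  have hB₀n : ¬ Hits (v + 1) B₀ := fun h => hB₀' h.hitsTwice
  have huniq : ∀ {w : ℕ} {F : Finset ℕ}, ¬ HitsTwice w F → ∀ {m m' : ℕ},
      2 * pre F m = m + w → 2 * pre F m' = m' + w → m = m' := by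
    intro w F hF m m' hm hm'
    rcases lt_trichotomy m m' with h | h | h
    · exact absurd ⟨m, m', h, hm.ge, hm'.ge⟩ hF
    · exact h
    · exact absurd ⟨m', m, h, hm'.ge, hm.ge⟩ hF
  obtain ⟨j, hjA, hjB⟩ := key A₀ hA₀ B₀ hB₀ hA₀n hB₀n
  refine ⟨j, ?_, ?_, ⟨A₀, hA₀, hjA⟩, ⟨B₀, hB₀, hjB⟩⟩
  · intro A hA
    by_cases h : Hits (u + 1) A
    · exact Or.inl h
    · obtain ⟨m, hm, hm'⟩ := key A hA B₀ hB₀ h hB₀n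
      rw [huniq hB₀' hjB hm']
      exact Or.inr hm
  · intro B hB
    by_cases h : Hits (v + 1) B
    · exact Or.inl h
    · obtain ⟨m, hm, hm'⟩ := key A₀ hA₀ B hB hA₀n h
      rw [huniq hA₀' hjA hm]
      exact Or.inr hm'

lemma card_le_of_forall_hits {n k u : ℕ} {𝒜 : Finset (Finset ℕ)}
    (h𝒜 : 𝒜 ⊆ powersetCard k (range n)) (hk : 2 * k ≤ n) (h : ∀ A ∈ 𝒜, Hits u A) :
    𝒜.card ≤ n.choose (k - u) := by
  classical
  refine le_trans ?_ (reflBinom_le n k u)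
  rw [← card_filter_hits (by omega : 2 * k ≤ n + u)]
  exact card_le_card fun A hA => mem_filter.2 ⟨h𝒜 hA, h A hA⟩

lemma card_le_of_forall_hitsTwice {n k u : ℕ} {𝒜 : Finset (Finset ℕ)}
    (h𝒜 : 𝒜 ⊆ powersetCard k (range n)) (hk : 2 * k ≤ n) (h : ∀ A ∈ 𝒜, HitsTwice u A) :
    𝒜.card ≤ 2 * n.choose (k - (u + 1)) := by
  classical
  refine le_trans ?_ (Nat.mul_le_mul_left 2 (reflBinom_le n k (u + 1)))
  refine le_trans ?_ (card_filter_hitsTwice_le (by omega : 2 * k ≤ n + u))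
  exact card_le_card fun A hA => mem_filter.2 ⟨h𝒜 hA, h A hA⟩

lemma card_le_of_forall_touch {n k u i : ℕ} {𝒜 : Finset (Finset ℕ)}
    (h𝒜 : 𝒜 ⊆ powersetCard k (range n)) (hk : 2 * k ≤ n) (hj : u + 2 * i ≤ n) (hik : u + i ≤ k)
    (h : ∀ A ∈ 𝒜, Hits (u + 1) A ∨ 2 * pre A (u + 2 * i) = u + 2 * i + u) :
    𝒜.card ≤ n.choose (k - (u + 1)) +
      ballot u i * (n - (u + 2 * i)).choose (k - (u + i)) := by
  classical
  rw [← card_filter_add_card_filter_not (s := 𝒜) (Hits (u + 1))]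
  refine add_le_add ?_ (le_trans (card_le_card ?_) (card_filter_touch_le hj hik))
  · exact card_le_of_forall_hits ((filter_subset _ _).trans h𝒜) hk
      fun A hA => (mem_filter.1 hA).2
  · intro A hA
    rw [mem_filter] at hA ⊢
    exact ⟨h𝒜 hA.1, (h A hA.1).resolve_left hA.2, hA.2⟩

/-! ### Shifted families: gain and loss at the touching point -/

/-- The `k`-subsets of `{0, …, n - 1}` with at least `h` elements in `T`. -/
def slice (n k h : ℕ) (T : Finset ℕ) : Finset (Finset ℕ) :=
  (powersetCard k (range n)).filter (fun F => h ≤ (F ∩ T).card)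

lemma mem_slice_range {n k h j : ℕ} {F : Finset ℕ} :
    F ∈ slice n k h (range j) ↔ F ∈ powersetCard k (range n) ∧ h ≤ pre F j := mem_filter

/-- Suppose that `𝒜` is not contained in the slice through the touching point.  Let `y = x + u + l`
be the highest line that all members outside the slice reach.  Then `𝒜` gains at most the number
of walks reaching that line, while `ℬ` loses all the walks that start with a set of `S`, go right
`l + 1` times and never make a net gain afterwards.  The hypothesis `hSpre` makes the criterion
fail before step `j`, and `hnum` says that the loss outweighs the gain. -/
lemma exists_gain_loss {t n k u v j a b : ℕ} {𝒜 ℬ : Finset (Finset ℕ)}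
    (h𝒜 : 𝒜 ⊆ powersetCard k (range n)) (hk : 2 * k ≤ n) (hs : LeftClosed 𝒜)
    (hc : Cross t 𝒜 ℬ) (huv : u + v = 2 * t) (ha : 2 * a = j + u) (hb : 2 * b = j + v)
    (htouch : ∀ A ∈ 𝒜, Hits (u + 1) A ∨ 2 * pre A j = j + u)
    {S : Finset (Finset ℕ)} (hS : S ⊆ powersetCard b (range j)) (hbk : b ≤ k)
    (hSpre : ∀ A : Finset ℕ, pre A j < a → ∀ P ∈ S, ∀ m < j, pre A m + pre P m < m + t)
    (hn : ∀ l, u + l ≤ k → j + l + 1 ≤ n ∧ 2 * (k - b) ≤ n - (j + l + 1) + 1)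
    (hnum : ∀ l, 1 ≤ l → u + l ≤ k →
      (n.choose (k - (u + l)) : ℝ) * (slice n k b (range j)).card <
        (S.card * ((n - (j + l + 1)).choose (k - b) - reflBinom (n - (j + l + 1)) (k - b) 1) : ℕ) *
          ((slice n k a (range j)).card : ℝ)) :
    ∃ g l : ℝ, (𝒜.card : ℝ) ≤ (𝒜 ∩ slice n k a (range j)).card + g ∧
      ((ℬ ∩ slice n k b (range j)).card : ℝ) + l ≤ (slice n k b (range j)).card ∧
      g * (slice n k b (range j)).card ≤ l * (slice n k a (range j)).card ∧
      (¬ 𝒜 ⊆ slice n k a (range j) →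
        g * (slice n k b (range j)).card < l * (slice n k a (range j)).card) := by
  classical
  by_cases hsub : 𝒜 ⊆ slice n k a (range j)
  · refine ⟨0, 0, ?_, ?_, by simp, fun h => absurd hsub h⟩
    · rw [inter_eq_left.2 hsub, add_zero]
    · rw [add_zero]; exact_mod_cast card_le_card inter_subset_right
  set 𝒟 := 𝒜 \ slice n k a (range j) with h𝒟
  have hmem𝒟 : ∀ A, A ∈ 𝒟 ↔ A ∈ 𝒜 ∧ pre A j < a := by
    intro A
    rw [h𝒟, mem_sdiff, mem_slice_range]
    constructor
    · rintro ⟨h1, h2⟩; exact ⟨h1, by by_contra h3; exact h2 ⟨h𝒜 h1, by omega⟩⟩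
    · rintro ⟨h1, h2⟩; exact ⟨h1, fun h3 => by omega⟩
  obtain ⟨A₀, hA₀, hA₀'⟩ := not_subset.1 hsub
  have hA₀𝒟 : A₀ ∈ 𝒟 := mem_sdiff.2 ⟨hA₀, hA₀'⟩
  have hex : ∃ l, ¬ ∀ A ∈ 𝒟, Hits (u + l + 2) A := by
    refine ⟨k, fun h => ?_⟩
    have h1 := (h A₀ hA₀𝒟).le_card
    have h2 := (mem_powersetCard.1 (h𝒜 hA₀)).2
    omega
  set l := Nat.find hex with hl
  have hlspec := Nat.find_spec hex
  rw [← hl] at hlspec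
  have hl1 : ∀ A ∈ 𝒟, Hits (u + (l + 1)) A := by
    rcases Nat.eq_zero_or_pos l with h0 | h0
    · rw [h0]
      intro A hA
      have h1 := (hmem𝒟 A).1 hA
      rcases htouch A h1.1 with h2 | h2
      · exact h2
      · omega
    · have h1 := Nat.find_min hex (show l - 1 < Nat.find hex by omega)
      rw [not_not] at h1
      intro A hA
      have := h1 A hA
      rwa [show u + (l - 1) + 2 = u + (l + 1) by omega] at this
  push Not at hlspec
  obtain ⟨A₁, hA₁, hA₁'⟩ := hlspec
  obtain ⟨hA₁𝒜, hA₁j⟩ := (hmem𝒟 A₁).1 hA₁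
  have hlk : u + (l + 1) ≤ k := by
    have h1 := (hl1 A₀ hA₀𝒟).le_card
    have h2 := (mem_powersetCard.1 (h𝒜 hA₀)).2
    omega
  obtain ⟨hn1, hn2⟩ := hn (l + 1) hlk
  set c := j + (l + 1) + 1 with hcdef
  set 𝒯 := (powersetCard k (range n)).filter
    (fun F => F ∩ range c ∈ S ∧ ∀ m, c ≤ m → 2 * pre F m + c ≤ m + 2 * b) with h𝒯
  have hcard := card_mul_le_card_stalling (n := n) (k := k) hS (show j ≤ c by omega) hn1 hbk hn2
  have hnum' := hnum (l + 1) (by omega) hlk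
  have hpreT : ∀ F ∈ 𝒯, ∀ m ≤ c, pre F m = pre (F ∩ range c) m := by
    intro F _ m hm
    refine pre_congr fun x hx => ?_
    rw [mem_inter, mem_range]
    exact ⟨fun h => ⟨h, by omega⟩, fun h => h.1⟩
  have hT1 : 𝒯 ⊆ slice n k b (range j) := by
    intro F hF
    have h1 := mem_filter.1 hF
    refine mem_slice_range.2 ⟨h1.1, ?_⟩
    have h2 := mem_powersetCard.1 (hS h1.2.1)
    rw [hpreT F hF j (by omega), pre_eq_card h2.1 le_rfl, h2.2]
  have hT2 : ∀ F ∈ 𝒯, F ∉ ℬ := by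
    intro F hF hFℬ
    have h1 := mem_filter.1 hF
    have h2 := mem_powersetCard.1 (hS h1.2.1)
    obtain ⟨m, hm⟩ := exists_add_le_pre_add_pre hs hc hA₁𝒜 hFℬ
    rcases Nat.lt_or_ge m j with hmj | hmj
    · have h3 := hSpre A₁ hA₁j _ h1.2.1 m hmj
      rw [← hpreT F hF m (by omega)] at h3
      omega
    · rcases Nat.lt_or_ge m c with hmc | hmc
      · have h3 := pre_add_le A₁ hmj
        have h4 := hpreT F hF m hmc.le
        rw [pre_eq_card h2.1 hmj, h2.2] at h4
        omega
      · have h3 := h1.2.2 m hmc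
        have h4 := two_mul_pre_le_of_not_hits (u := u + l + 1) hA₁' m
        omega
  refine ⟨n.choose (k - (u + (l + 1))), 𝒯.card, ?_, ?_, ?_, fun _ => ?_⟩
  · have h1 := card_le_of_forall_hits (sdiff_subset.trans h𝒜) hk hl1
    have h2 := card_sdiff_add_card_inter 𝒜 (slice n k a (range j))
    have h3 : 𝒜.card ≤ (𝒜 ∩ slice n k a (range j)).card + n.choose (k - (u + (l + 1))) := by
      omega
    exact_mod_cast h3
  · have h1 : Disjoint (ℬ ∩ slice n k b (range j)) 𝒯 := by
      rw [disjoint_left]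
      intro F hF hF'
      exact hT2 F hF' (mem_inter.1 hF).1
    have h2 := card_le_card (union_subset (inter_subset_right (s₁ := ℬ)) hT1)
    rw [card_union_of_disjoint h1] at h2
    exact_mod_cast h2
  all_goals
    have h1 : ((S.card * ((n - c).choose (k - b) - reflBinom (n - c) (k - b) 1) : ℕ) : ℝ) ≤
      𝒯.card := by exact_mod_cast hcard
    have h2 := hnum'.trans_le (mul_le_mul_of_nonneg_right h1
      (Nat.cast_nonneg (slice n k a (range j)).card))
  · exact h2.le
  · exact h2

/-- If the gains of both families are outweighed by the losses they cause in the other one, then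
the product of the cardinalities does not exceed that of the two slices. -/
lemma card_mul_card_le_of_gain_loss {𝒜 ℬ 𝒳 𝒴 : Finset (Finset ℕ)}
    (h𝒳 : 𝒳.Nonempty) (h𝒴 : 𝒴.Nonempty)
    (h1 : ∃ g l : ℝ, (𝒜.card : ℝ) ≤ (𝒜 ∩ 𝒳).card + g ∧ ((ℬ ∩ 𝒴).card : ℝ) + l ≤ 𝒴.card ∧
      g * 𝒴.card ≤ l * 𝒳.card ∧ (¬ 𝒜 ⊆ 𝒳 → g * 𝒴.card < l * 𝒳.card))
    (h2 : ∃ g l : ℝ, (ℬ.card : ℝ) ≤ (ℬ ∩ 𝒴).card + g ∧ ((𝒜 ∩ 𝒳).card : ℝ) + l ≤ 𝒳.card ∧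
      g * 𝒳.card ≤ l * 𝒴.card ∧ (¬ ℬ ⊆ 𝒴 → g * 𝒳.card < l * 𝒴.card)) :
    𝒜.card * ℬ.card ≤ 𝒳.card * 𝒴.card ∧
      (𝒜.card * ℬ.card = 𝒳.card * 𝒴.card → 𝒜 = 𝒳 ∧ ℬ = 𝒴) := by
  obtain ⟨g, l, ha, hb, hgl, hgl'⟩ := h1
  obtain ⟨g', l', ha', hb', hgl2, hgl2'⟩ := h2
  set A : ℝ := (𝒜.card : ℝ) with hA
  set B : ℝ := (ℬ.card : ℝ) with hB
  set X : ℝ := (𝒳.card : ℝ) with hX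
  set Y : ℝ := (𝒴.card : ℝ) with hY
  have hX0 : 0 < X := by rw [hX]; exact_mod_cast h𝒳.card_pos
  have hY0 : 0 < Y := by rw [hY]; exact_mod_cast h𝒴.card_pos
  have hA0 : 0 ≤ A := Nat.cast_nonneg _
  have hB0 : 0 ≤ B := Nat.cast_nonneg _
  have e1 : A * Y ≤ (X - l' + g) * Y := by gcongr; linarith
  have e2 : B * X ≤ (Y - l + g') * X := by gcongr; linarith
  have hsum : A * Y + B * X ≤ 2 * (X * Y) + (g * Y - l * X) + (g' * X - l' * Y) := by nlinarith
  -- the arithmetic-geometric mean inequality for `A / X` and `B / Y`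
  have amgm : 4 * ((A * B) * (X * Y)) ≤ (A * Y + B * X) ^ 2 := by
    nlinarith [sq_nonneg (A * Y - B * X)]
  have hXY : 0 < X * Y := mul_pos hX0 hY0
  have hs0 : 0 ≤ A * Y + B * X := by positivity
  have hle : A * B ≤ X * Y := by
    have h3 : A * Y + B * X ≤ 2 * (X * Y) := by linarith
    have h4 : (A * Y + B * X) ^ 2 ≤ (2 * (X * Y)) ^ 2 := by gcongr
    refine le_of_mul_le_mul_right ?_ hXY
    nlinarith
  refine ⟨by rw [hA, hB, hX, hY] at hle; exact_mod_cast hle, fun heq => ?_⟩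
  have heq' : A * B = X * Y := by rw [hA, hB, hX, hY]; exact_mod_cast heq
  -- equality leaves no room for a strict gain in either family
  have hno : ¬ A * Y + B * X < 2 * (X * Y) := by
    intro h3
    have h4 : (A * Y + B * X) ^ 2 < (2 * (X * Y)) ^ 2 := by gcongr
    rw [heq'] at amgm
    nlinarith
  have hs1 : 𝒜 ⊆ 𝒳 := by
    by_contra h3
    have := hgl' h3
    exact hno (by linarith)
  have hs2 : ℬ ⊆ 𝒴 := by
    by_contra h3
    have := hgl2' h3
    exact hno (by linarith)
  have hc1 := card_le_card hs1
  have hc2 := card_le_card hs2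
  have hp1 := h𝒳.card_pos
  have hp2 := h𝒴.card_pos
  constructor
  · refine eq_of_subset_of_card_le hs1 ?_
    by_contra! h3
    have : 𝒜.card * ℬ.card < 𝒳.card * 𝒴.card := by nlinarith
    omega
  · refine eq_of_subset_of_card_le hs2 ?_
    by_contra! h3
    have : 𝒜.card * ℬ.card < 𝒳.card * 𝒴.card := by nlinarith
    omega

/-! ### The sizes of the slices -/

lemma card_slice_range_self {n k j : ℕ} (hj : j ≤ n) (hjk : j ≤ k) :
    (slice n k j (range j)).card = (n - j).choose (k - j) := by
  have h := card_filter_inter_range_mem (n := n) (k := k) (j := j) (a := j) (S := {range j})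
    (by simp) hj hjk
  rw [card_singleton, one_mul] at h
  rw [← h]
  congr 1
  refine filter_congr fun F _ => ?_
  rw [mem_singleton]
  constructor
  · intro h1
    exact eq_of_subset_of_card_le inter_subset_right (by rwa [card_range])
  · intro h1; rw [h1, card_range]

lemma card_slice_range_succ {n k j : ℕ} (hj : j + 1 ≤ n) (hjk : j + 1 ≤ k) :
    (slice n k j (range (j + 1))).card =
      (j + 1) * (n - (j + 1)).choose (k - j) + (n - (j + 1)).choose (k - (j + 1)) := by
  have h := card_filter_inter_range_mem (n := n) (k := k) (j := j + 1) (a := j)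
    (S := powersetCard j (range (j + 1))) subset_rfl hj (by omega)
  rw [card_powersetCard, card_range, Nat.choose_succ_self_right] at h
  rw [← h, ← card_slice_range_self hj hjk, slice, slice, ← card_union_of_disjoint]
  · congr 1
    ext F
    have : (F ∩ range (j + 1)).card ≤ j + 1 := pre_le F (j + 1)
    simp only [mem_union, mem_filter, mem_powersetCard, inter_subset_right, true_and]
    constructor
    · rintro ⟨h1, h2⟩
      rcases Nat.lt_or_eq_of_le h2 with h3 | h3
      · exact Or.inr ⟨h1, h3⟩
      · exact Or.inl ⟨h1, h3.symm⟩
    · rintro (⟨h1, h2⟩ | ⟨h1, h2⟩)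
      · exact ⟨h1, h2.ge⟩
      · exact ⟨h1, by omega⟩
  · rw [disjoint_filter]
    intro F _ h1 h2
    have := (mem_powersetCard.1 h1).2
    omega

/-! ### Shifted families: the bound -/

lemma choose_add_le_one_add_inv_pow {t N m : ℕ} (d : ℕ) (ht : 0 < t) (h : (t + 1) * m ≤ N + 1) :
    ((N + d).choose m : ℝ) ≤ (1 + 1 / (t : ℝ)) ^ d * N.choose m := by
  have h1 : ((t : ℝ)) ^ d * (N + d).choose m ≤ ((t : ℝ) + 1) ^ d * N.choose m := by
    exact_mod_cast pow_mul_choose_add_le d h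
  have ht' : (0 : ℝ) < t := by exact_mod_cast ht
  have h2 : (1 + 1 / (t : ℝ)) = (t + 1) / t := by field_simp
  rw [h2, div_pow, div_mul_eq_mul_div, le_div_iff₀ (by positivity)]
  linarith

/-- A lower bound for the number of walks that make no net gain after `d` right steps. -/
lemma le_choose_sub_reflBinom {t N m : ℕ} (d : ℕ) (ht : 2 ≤ t) (h : t * m ≤ N + 1) :
    ((t - 1 : ℝ) / t) ^ d * ((t - 2) / (t - 1)) * (N + d).choose m ≤
      ((N.choose m - reflBinom N m 1 : ℕ) : ℝ) := by
  obtain ⟨s, rfl⟩ : ∃ s, t = s + 1 := ⟨t - 1, by omega⟩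
  have hs : (1 : ℝ) ≤ s := by exact_mod_cast (by omega : 1 ≤ s)
  have h1 : ((s : ℝ)) ^ d * (N + d).choose m ≤ ((s : ℝ) + 1) ^ d * N.choose m := by
    exact_mod_cast pow_mul_choose_add_le d h
  have h2 : s * reflBinom N m 1 ≤ N.choose m := by
    unfold reflBinom
    split_ifs with hm
    · exact mul_choose_sub_one_le hm h
    · simp
  have h3 : reflBinom N m 1 ≤ N.choose m :=
    (Nat.le_mul_of_pos_left _ (by omega)).trans h2
  have h2' : (s : ℝ) * reflBinom N m 1 ≤ N.choose m := by exact_mod_cast h2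
  rw [Nat.cast_sub h3]
  push_cast
  have e1 : ((s : ℝ) + 1 - 1) / (s + 1) = s / (s + 1) := by ring
  have e2 : ((s : ℝ) + 1 - 2) / (s + 1 - 1) = (s - 1) / s := by congr 1 <;> ring
  rw [e1, e2]
  have h4 : (s / (s + 1) : ℝ) ^ d * (N + d).choose m ≤ N.choose m := by
    rw [div_pow, div_mul_eq_mul_div, div_le_iff₀ (by positivity)]
    linarith
  have h5 : (0 : ℝ) ≤ (s - 1) / s := div_nonneg (by linarith) (by linarith)
  calc (s / (s + 1) : ℝ) ^ d * ((s - 1) / s) * (N + d).choose m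
      = (s - 1) / s * ((s / (s + 1) : ℝ) ^ d * (N + d).choose m) := by ring
    _ ≤ (s - 1) / s * N.choose m := by gcongr
    _ ≤ _ := by
      rw [div_mul_eq_mul_div, div_le_iff₀ (by linarith)]
      linarith

/-- The form in which `gain_lt_loss` is used: `Y` is the common unit of the gain `G` and of the
loss `L`. -/
lemma gain_lt_loss_of_le {t l : ℕ} (ht : 14 ≤ t) (hl : 1 ≤ l) {G L Y : ℝ} (hY : 0 < Y)
    (hG : t ^ l * G ≤ (1 + 1 / (t : ℝ)) ^ (t + 3) * Y)
    (hL : ((t - 1 : ℝ) / t) ^ (l + 1) * ((t - 2) / (t - 1)) * Y ≤ L) : G < L := by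
  have h := gain_lt_loss ht hl
  have ht' : (0 : ℝ) < (t : ℝ) ^ l := by
    have : (0 : ℝ) < t := by exact_mod_cast (by omega : 0 < t)
    positivity
  refine lt_of_mul_lt_mul_left ?_ ht'.le
  calc (t : ℝ) ^ l * G ≤ (1 + 1 / (t : ℝ)) ^ (t + 3) * Y := hG
    _ < t ^ l * (((t - 1 : ℝ) / t) ^ (l + 1) * ((t - 2) / (t - 1))) * Y := by gcongr
    _ = t ^ l * (((t - 1 : ℝ) / t) ^ (l + 1) * ((t - 2) / (t - 1)) * Y) := by ring
    _ ≤ _ := by gcongr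

lemma one_add_inv_pow_le_one_add_inv_pow {t a b : ℕ} (h : a ≤ b) :
    (1 + 1 / (t : ℝ)) ^ a ≤ (1 + 1 / (t : ℝ)) ^ b := by
  refine pow_le_pow_right₀ ?_ h
  have : (0 : ℝ) ≤ 1 / t := by positivity
  linarith

section

variable {t K n : ℕ}

lemma two_mul_le_of_le (ht : 14 ≤ t) (hK : t + 1 ≤ K) (hn : (t + 1) * (K + 1) ≤ n) :
    2 * (t + K) ≤ n := by
  nlinarith

lemma mul_add_le_of_le (hn : (t + 1) * (K + 1) ≤ n) : t * K + K + t + 1 ≤ n := by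
  linarith

lemma choose_le_one_add_inv_pow_mul (ht : 14 ≤ t) (hn : (t + 1) * (K + 1) ≤ n) :
    (n.choose K : ℝ) ≤ (1 + 1 / (t : ℝ)) ^ t * (n - t).choose K := by
  have h1 := mul_add_le_of_le hn
  have h := choose_add_le_one_add_inv_pow (t := t) (N := n - t) (m := K) t (by omega)
    (by have : (t + 1) * K = t * K + K := by ring
        omega)
  rwa [Nat.sub_add_cancel (by omega)] at h

/-- The bound for families of walks reaching lines whose levels add up to more than `2 t`.  The
factor `2` serves the families of walks touching a line twice. -/
lemma two_mul_choose_mul_choose_lt (ht : 14 ≤ t) (hK : t + 1 ≤ K) (hn : (t + 1) * (K + 1) ≤ n)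
    {u v : ℕ} (huv : u + v = 2 * t + 1) :
    2 * (n.choose (t + K - u) * n.choose (t + K - v)) < (n - t).choose K ^ 2 := by
  wlog huv' : v ≤ u generalizing u v
  · rw [mul_comm (n.choose _)]
    exact this (by omega) (by omega)
  have h0 := mul_add_le_of_le hn
  have h1 : n.choose (t + K - u) * n.choose (t + K - v) ≤ n.choose (K - 1) * n.choose K := by
    have := choose_sub_mul_choose_add_le (n := n) (a := K - 1) (b := K) (u - (t + 1))
      (by omega) (by omega)
    rwa [show K - 1 - (u - (t + 1)) = t + K - u by omega,
      show K + (u - (t + 1)) = t + K - v by omega] at this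
  have h2 : t * n.choose (K - 1) ≤ n.choose K :=
    mul_choose_sub_one_le (by omega) (by have : (t + 1) * K = t * K + K := by ring
                                         omega)
  have h3 := choose_le_one_add_inv_pow_mul ht hn
  have h4 := two_mul_one_add_inv_pow_sq_lt ht
  have hM : (0 : ℝ) < (n - t).choose K := by
    exact_mod_cast Nat.choose_pos (by nlinarith [Nat.sub_add_cancel (show t ≤ n by omega)])
  set E : ℝ := (1 + 1 / (t : ℝ)) ^ t with hE
  have hE0 : 0 < E := by positivity
  have ht' : (0 : ℝ) < t := by exact_mod_cast (by omega : 0 < t)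
  have h2' : (t : ℝ) * n.choose (K - 1) ≤ n.choose K := by exact_mod_cast h2
  have h5 : (t : ℝ) * (2 * (n.choose (K - 1) * n.choose K)) < t * ((n - t).choose K : ℝ) ^ 2 := by
    calc (t : ℝ) * (2 * (n.choose (K - 1) * n.choose K))
        = 2 * ((t * n.choose (K - 1)) * n.choose K) := by ring
      _ ≤ 2 * (n.choose K * n.choose K) := by gcongr
      _ ≤ 2 * ((E * (n - t).choose K) * (E * (n - t).choose K)) := by gcongr
      _ = 2 * E ^ 2 * ((n - t).choose K : ℝ) ^ 2 := by ring
      _ < _ := by gcongr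
  have h6 : 2 * (n.choose (K - 1) * n.choose K) < (n - t).choose K ^ 2 := by
    have := lt_of_mul_lt_mul_left h5 ht'.le
    exact_mod_cast this
  exact lt_of_le_of_lt (Nat.mul_le_mul_left 2 h1) h6

/-- The bound for the touching points `(i, t + s + i)` and `(i + s, t + i)` with `i + s ≥ 2`.  In
each factor the first summand counts the walks crossing the line and the second one those through
the touching point.  The four mixed products are estimated separately, as an index such as
`K - 1 + s` is only harmless in combination with its counterpart. -/
lemma touch_product_lt (ht : 14 ≤ t) (hK : t + 1 ≤ K) (hn : (t + 1) * (K + 1) ≤ n)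
    {s i : ℕ} (hs : s ≤ t) (hi : 2 ≤ i + s) (hiK : i + s ≤ K) :
    (n.choose (K - 1 - s) + ballot (t + s) i * (n - (t + s + 2 * i)).choose (K - s - i)) *
      (n.choose (K - 1 + s) + ballot (t - s) (i + s) * (n - (t + s + 2 * i)).choose (K - i)) <
      (n - t).choose K ^ 2 := by
  have h0 := mul_add_le_of_le hn
  have htK : (t + 1) * K = t * K + K := by ring
  have ht' : (14 : ℝ) ≤ t := by exact_mod_cast ht
  have ht0 : (0 : ℝ) < t := by linarith
  have hM : (0 : ℝ) < (n - t).choose K := by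
    exact_mod_cast Nat.choose_pos (by omega)
  have hE := choose_le_one_add_inv_pow_mul ht hn
  set E : ℝ := (1 + 1 / (t : ℝ)) ^ t with hEdef
  have hE0 : 0 < E := by positivity
  set M : ℝ := ((n - t).choose K : ℝ) with hMdef
  set x : ℝ := (ballot (t + s) i : ℝ) with hx
  set y : ℝ := (ballot (t - s) (i + s) : ℝ) with hy
  have hx0 : 0 ≤ x := Nat.cast_nonneg _
  have hy0 : 0 ≤ y := Nat.cast_nonneg _
  set a₁ : ℝ := (n.choose (K - 1 - s) : ℝ) with ha₁
  set a₂ : ℝ := ((n - (t + s + 2 * i)).choose (K - s - i) : ℝ) with ha₂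
  set b₁ : ℝ := (n.choose (K - 1 + s) : ℝ) with hb₁
  set b₂ : ℝ := ((n - (t + s + 2 * i)).choose (K - i) : ℝ) with hb₂
  have ha₁0 : 0 ≤ a₁ := Nat.cast_nonneg _
  have ha₂0 : 0 ≤ a₂ := Nat.cast_nonneg _
  have hb₁0 : 0 ≤ b₁ := Nat.cast_nonneg _
  have hb₂0 : 0 ≤ b₂ := Nat.cast_nonneg _
  -- the central coefficient `n.choose (K - 1)`
  have hcen : (n.choose (K - 1) : ℝ) ≤ E / t * M := by
    have h1 : (t : ℝ) * n.choose (K - 1) ≤ n.choose K := by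
      exact_mod_cast mul_choose_sub_one_le (by omega) (by omega)
    rw [div_mul_eq_mul_div, le_div_iff₀ ht0]
    linarith
  have p11 : a₁ * b₁ ≤ (E / t) ^ 2 * M ^ 2 := by
    have h1 : a₁ * b₁ ≤ (n.choose (K - 1) : ℝ) * n.choose (K - 1) := by
      rw [ha₁, hb₁]
      exact_mod_cast choose_sub_mul_choose_add_le (n := n) (a := K - 1) s (by omega) le_rfl
    calc a₁ * b₁ ≤ (n.choose (K - 1) : ℝ) * n.choose (K - 1) := h1
      _ ≤ (E / t * M) * (E / t * M) := by gcongr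
      _ = _ := by ring
  have q1 : a₁ ≤ E / t * M / t ^ s := by
    have h1 : (t : ℝ) ^ (s + 1) * a₁ ≤ n.choose K := by
      rw [ha₁, show K - 1 - s = K - (s + 1) by omega]
      exact_mod_cast pow_mul_choose_sub_le (s + 1) (by omega) (by omega)
    rw [le_div_iff₀ (by positivity), div_mul_eq_mul_div, le_div_iff₀ ht0]
    calc a₁ * t ^ s * t = (t : ℝ) ^ (s + 1) * a₁ := by ring
      _ ≤ _ := h1.trans hE
  have q2 : b₂ ≤ M / (t + 1) ^ i := by
    have h1 : (t + 1) ^ i * (n - t - i).choose (K - i) ≤ (n - t).choose K :=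
      pow_mul_choose_sub_sub_le i (by omega) (by omega)
    have h2 : (n - (t + s + 2 * i)).choose (K - i) ≤ (n - t - i).choose (K - i) :=
      Nat.choose_le_choose _ (by omega)
    rw [le_div_iff₀ (by positivity), mul_comm, hb₂, hMdef]
    exact_mod_cast (Nat.mul_le_mul_left ((t + 1) ^ i) h2).trans h1
  have q3 : a₂ ≤ M / (t + 1) ^ (s + i) := by
    have h1 : (t + 1) ^ (s + i) * (n - t - (s + i)).choose (K - (s + i)) ≤ (n - t).choose K :=
      pow_mul_choose_sub_sub_le (s + i) (by omega) (by omega)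
    have h2 : (n - (t + s + 2 * i)).choose (K - s - i) ≤
        (n - t - (s + i)).choose (K - (s + i)) := by
      rw [Nat.sub_sub K]; exact Nat.choose_le_choose _ (by omega)
    rw [le_div_iff₀ (by positivity), mul_comm, ha₂, hMdef]
    exact_mod_cast (Nat.mul_le_mul_left ((t + 1) ^ (s + i)) h2).trans h1
  have p12 : a₁ * b₂ ≤ E / t / (t ^ s * (t + 1) ^ i) * M ^ 2 := by
    calc a₁ * b₂ ≤ (E / t * M / t ^ s) * (M / (t + 1) ^ i) := by gcongr
      _ = _ := by field_simp
  have p21 : a₂ * b₁ ≤ E / t / (t + 1) ^ i * M ^ 2 := by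
    have h1 : (t + 1) ^ i * (n - t - s - i).choose (K - s - i) ≤ (n - t - s).choose (K - s) := by
      refine pow_mul_choose_sub_sub_le i (by omega) ?_
      have h3 : (t + 1) * (K - s) + (t + 1) * s = (t + 1) * K := by
        rw [← mul_add, Nat.sub_add_cancel (by omega)]
      have h4 : (t + 1) * s = t * s + s := by ring
      have h5 : 0 ≤ t * s := Nat.zero_le _
      omega
    have h2 : (n - (t + s + 2 * i)).choose (K - s - i) ≤ (n - t - s - i).choose (K - s - i) :=
      Nat.choose_le_choose _ (by omega)
    have h3 : (((n - t - s).choose (K - s) : ℝ)) * b₁ ≤ M * n.choose (K - 1) := by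
      rw [hb₁, hMdef]
      exact_mod_cast choose_sub_sub_mul_choose_add_le (n := n) (t := t) (K := K) s (by omega) hK
        (by omega)
    have h4 : ((t : ℝ) + 1) ^ i * a₂ ≤ (n - t - s).choose (K - s) := by
      rw [ha₂]
      exact_mod_cast (Nat.mul_le_mul_left ((t + 1) ^ i) h2).trans h1
    rw [div_mul_eq_mul_div, le_div_iff₀ (by positivity)]
    calc a₂ * b₁ * (t + 1) ^ i = ((t : ℝ) + 1) ^ i * a₂ * b₁ := by ring
      _ ≤ (n - t - s).choose (K - s) * b₁ := by gcongr
      _ ≤ M * n.choose (K - 1) := h3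
      _ ≤ M * (E / t * M) := by gcongr
      _ = _ := by ring
  have p22 : a₂ * b₂ ≤ 1 / (t + 1) ^ i / (t ^ s * (t + 1) ^ i) * M ^ 2 := by
    calc a₂ * b₂ ≤ (M / (t + 1) ^ (s + i)) * (M / (t + 1) ^ i) := by gcongr
      _ = 1 / (t + 1) ^ i / ((t + 1) ^ s * (t + 1) ^ i) * M ^ 2 := by rw [pow_add]; field_simp
      _ ≤ _ := by gcongr; linarith
  have hfin := add_ballot_mul_add_ballot_lt ht hs hi (ε := E / t) (by positivity)
    (one_add_inv_pow_div_lt ht)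
  have hreal : (a₁ + x * a₂) * (b₁ + y * b₂) < M ^ 2 := by
    calc (a₁ + x * a₂) * (b₁ + y * b₂)
        = a₁ * b₁ + y * (a₁ * b₂) + x * (a₂ * b₁) + x * y * (a₂ * b₂) := by ring
      _ ≤ (E / t) ^ 2 * M ^ 2 + y * (E / t / (t ^ s * (t + 1) ^ i) * M ^ 2) +
          x * (E / t / (t + 1) ^ i * M ^ 2) +
          x * y * (1 / (t + 1) ^ i / (t ^ s * (t + 1) ^ i) * M ^ 2) := by gcongr
      _ = (E / t + x / (t + 1) ^ i) * (E / t + y / (t ^ s * (t + 1) ^ i)) * M ^ 2 := by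
          field_simp
          ring
      _ < 1 * M ^ 2 := by gcongr
      _ = _ := one_mul _
  rw [ha₁, ha₂, hb₁, hb₂, hx, hy, hMdef] at hreal
  exact_mod_cast hreal

end

/-! ### Shifted families: the three critical touching points -/

section

/-- The initial segment `{0, …, j - 1}` with one of its first `t` elements removed. -/
def puncturedSegments (t j : ℕ) : Finset (Finset ℕ) :=
  (range t).image (fun x => (range j).erase x)

lemma card_puncturedSegments {t j : ℕ} (h : t ≤ j) : (puncturedSegments t j).card = t := by
  unfold puncturedSegments
  rw [card_image_of_injOn, card_range]
  intro x hx y hy hxy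
  simp only [coe_range, Set.mem_Iio] at hx hy
  by_contra hne
  have h1 : x ∈ (range j).erase y := mem_erase.2 ⟨hne, mem_range.2 (by omega)⟩
  have h2 : (range j).erase x = (range j).erase y := hxy
  rw [← h2] at h1
  simp at h1

lemma puncturedSegments_subset {t j : ℕ} (h : t ≤ j + 1) :
    puncturedSegments t (j + 1) ⊆ powersetCard j (range (j + 1)) := by
  intro P hP
  obtain ⟨x, hx, rfl⟩ := mem_image.1 hP
  rw [mem_range] at hx
  rw [mem_powersetCard, card_erase_of_mem (mem_range.2 (by omega)), card_range]
  exact ⟨erase_subset _ _, rfl⟩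

lemma pre_lt_of_mem_puncturedSegments {t j m : ℕ} {P : Finset ℕ} (hP : P ∈ puncturedSegments t j)
    (hm : t ≤ m) : pre P m < m := by
  obtain ⟨x, hx, rfl⟩ := mem_image.1 hP
  rw [mem_range] at hx
  exact pre_lt_of_notMem (x := x) (by simp) (by omega)

variable {t K n : ℕ} {𝒜 ℬ : Finset (Finset ℕ)}

/-- Both families touch at the point `(0, t)`. -/
lemma card_mul_card_le_of_touch_zero (ht : 14 ≤ t) (hK : t + 1 ≤ K) (hn : (t + 1) * (K + 1) ≤ n)
    (h𝒜 : 𝒜 ⊆ powersetCard (t + K) (range n)) (hℬ : ℬ ⊆ powersetCard (t + K) (range n))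
    (hs𝒜 : LeftClosed 𝒜) (hsℬ : LeftClosed ℬ) (hc : Cross t 𝒜 ℬ)
    (ht𝒜 : ∀ A ∈ 𝒜, Hits (t + 1) A ∨ 2 * pre A t = t + t)
    (htℬ : ∀ B ∈ ℬ, Hits (t + 1) B ∨ 2 * pre B t = t + t) :
    𝒜.card * ℬ.card ≤ (n - t).choose K ^ 2 ∧
      (𝒜.card * ℬ.card = (n - t).choose K ^ 2 →
        𝒜 = slice n (t + K) t (range t) ∧ ℬ = slice n (t + K) t (range t)) := by
  have h0 := mul_add_le_of_le hn
  have h14 : 14 * K ≤ t * K := Nat.mul_le_mul_right K ht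
  have hX : (slice n (t + K) t (range t)).card = (n - t).choose K := by
    rw [card_slice_range_self (by omega) (by omega), Nat.add_sub_cancel_left]
  have hM : 0 < (n - t).choose K := Nat.choose_pos (by omega)
  have hMr : (0 : ℝ) < (n - t).choose K := by exact_mod_cast hM
  have side : ∀ 𝒞 𝒟 : Finset (Finset ℕ), 𝒞 ⊆ powersetCard (t + K) (range n) → LeftClosed 𝒞 →
      Cross t 𝒞 𝒟 → (∀ A ∈ 𝒞, Hits (t + 1) A ∨ 2 * pre A t = t + t) → _ :=
    fun 𝒞 𝒟 h𝒞 hs hc htouch => exists_gain_loss (ℬ := 𝒟) (a := t) (b := t) (v := t) h𝒞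
      (two_mul_le_of_le ht hK hn) hs hc (by omega) (by omega) (by omega) htouch
      (S := {range t}) (by simp) (by omega)
      (fun A hA P hP m hm => by
        have := pre_le A m
        have := pre_le P m
        omega)
      (fun l hl => by omega)
      (fun l hl hlK => by
        rw [hX, card_singleton, one_mul, show t + K - (t + l) = K - l by omega,
          Nat.add_sub_cancel_left]
        refine gain_lt_loss_of_le ht hl (mul_pos hMr hMr) ?_ ?_
        · have h1 : (t : ℝ) ^ l * n.choose (K - l) ≤ n.choose K := by
            exact_mod_cast pow_mul_choose_sub_le l (by omega)
              (by have : (t + 1) * K = t * K + K := by ring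
                  omega)
          have h2 := choose_le_one_add_inv_pow_mul ht hn
          have h3 := one_add_inv_pow_le_one_add_inv_pow (t := t) (show t ≤ t + 3 by omega)
          calc (t : ℝ) ^ l * (n.choose (K - l) * (n - t).choose K)
              = (t ^ l * n.choose (K - l)) * (n - t).choose K := by ring
            _ ≤ ((1 + 1 / (t : ℝ)) ^ (t + 3) * (n - t).choose K) * (n - t).choose K :=
                mul_le_mul_of_nonneg_right (h1.trans (h2.trans (by gcongr))) hMr.le
            _ = _ := by ring
        · have h1 := le_choose_sub_reflBinom (t := t) (N := n - (t + l + 1)) (m := K) (l + 1)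
            (by omega) (by omega)
          rw [show n - (t + l + 1) + (l + 1) = n - t by omega] at h1
          rw [← mul_assoc]
          gcongr)
  have hne : (slice n (t + K) t (range t)).Nonempty := card_pos.1 (by rw [hX]; exact hM)
  have h := card_mul_card_le_of_gain_loss hne hne (side 𝒜 ℬ h𝒜 hs𝒜 hc ht𝒜)
    (side ℬ 𝒜 hℬ hsℬ hc.symm htℬ)
  rwa [hX, ← sq] at h

/-- The size of the second extremal family. -/
lemma card_slice_range_add_two (ht : 14 ≤ t) (hK : t + 1 ≤ K) (hn : (t + 1) * (K + 1) ≤ n) :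
    (slice n (t + K) (t + 1) (range (t + 2))).card ≤ (n - t).choose K ∧
      ((slice n (t + K) (t + 1) (range (t + 2))).card = (n - t).choose K ↔
        n = (t + 1) * (K + 1)) := by
  have h0 := mul_add_le_of_le hn
  have hX := card_slice_range_succ (n := n) (k := t + K) (j := t + 1) (by omega) (by omega)
  rw [show t + 1 + 1 = t + 2 by omega, show t + K - (t + 1) = K - 1 by omega,
    show t + K - (t + 2) = K - 2 by omega] at hX
  obtain ⟨k', rfl⟩ : ∃ k', K = k' + 2 := ⟨K - 2, by omega⟩
  obtain ⟨N, hN⟩ : ∃ N, n - (t + 2) = N := ⟨_, rfl⟩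
  have hM : (n - t).choose (k' + 2) =
      N.choose k' + 2 * N.choose (k' + 1) + N.choose (k' + 2) := by
    rw [show n - t = N + 2 by omega, Nat.choose_succ_succ', Nat.choose_succ_succ',
      Nat.choose_succ_succ' N (k' + 1)]
    ring
  rw [hN] at hX
  simp only [show k' + 2 - 1 = k' + 1 by omega, Nat.add_sub_cancel] at hX
  have h1 := Nat.choose_succ_right_eq N (k' + 1)
  have hpos : 0 < N.choose (k' + 1) := Nat.choose_pos (by omega)
  have e1 : (t + 1) * (k' + 2 + 1) = t * (k' + 2) + t + (k' + 2) + 1 := by ring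
  have key : t * N.choose (k' + 1) ≤ N.choose (k' + 2) ∧
      (t * N.choose (k' + 1) = N.choose (k' + 2) ↔ n = (t + 1) * (k' + 2 + 1)) := by
    have h2 : t * (k' + 2) ≤ N - (k' + 1) := by omega
    constructor
    · refine Nat.le_of_mul_le_mul_right (c := k' + 1 + 1) ?_ (Nat.succ_pos _)
      rw [h1]
      calc t * N.choose (k' + 1) * (k' + 1 + 1) = N.choose (k' + 1) * (t * (k' + 2)) := by ring
        _ ≤ _ := Nat.mul_le_mul_left _ h2
    · have h3 : t * N.choose (k' + 1) = N.choose (k' + 2) ↔ t * (k' + 2) = N - (k' + 1) := by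
        rw [← Nat.mul_right_cancel_iff (Nat.succ_pos (k' + 1)), Nat.succ_eq_add_one, h1,
          show t * N.choose (k' + 1) * (k' + 1 + 1) = N.choose (k' + 1) * (t * (k' + 2)) by ring,
          Nat.mul_left_cancel_iff hpos]
      rw [h3]
      omega
  have e2 : (t + 2) * N.choose (k' + 1) = t * N.choose (k' + 1) + 2 * N.choose (k' + 1) := by
    ring
  refine ⟨by omega, ?_⟩
  rw [← key.2]
  omega

/-- Both families touch at the point `(1, t + 1)`. -/
lemma card_mul_card_le_of_touch_one (ht : 14 ≤ t) (hK : t + 1 ≤ K) (hn : (t + 1) * (K + 1) ≤ n)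
    (h𝒜 : 𝒜 ⊆ powersetCard (t + K) (range n)) (hℬ : ℬ ⊆ powersetCard (t + K) (range n))
    (hs𝒜 : LeftClosed 𝒜) (hsℬ : LeftClosed ℬ) (hc : Cross t 𝒜 ℬ)
    (ht𝒜 : ∀ A ∈ 𝒜, Hits (t + 1) A ∨ 2 * pre A (t + 2) = t + 2 + t)
    (htℬ : ∀ B ∈ ℬ, Hits (t + 1) B ∨ 2 * pre B (t + 2) = t + 2 + t) :
    𝒜.card * ℬ.card ≤ (n - t).choose K ^ 2 ∧
      (𝒜.card * ℬ.card = (n - t).choose K ^ 2 → n = (t + 1) * (K + 1) ∧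
        𝒜 = slice n (t + K) (t + 1) (range (t + 2)) ∧
        ℬ = slice n (t + K) (t + 1) (range (t + 2))) := by
  have h0 := mul_add_le_of_le hn
  have h14 : 14 * K ≤ t * K := Nat.mul_le_mul_right K ht
  obtain ⟨hXM, hXM'⟩ := card_slice_range_add_two ht hK hn
  have hX := card_slice_range_succ (n := n) (k := t + K) (j := t + 1) (by omega) (by omega)
  rw [show t + 1 + 1 = t + 2 by omega, show t + K - (t + 1) = K - 1 by omega] at hX
  set X := (slice n (t + K) (t + 1) (range (t + 2))).card with hXdef
  have hYpos : 0 < (n - (t + 2)).choose (K - 1) := Nat.choose_pos (by omega)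
  have hXpos : 0 < X := by
    rw [hX]
    have : 0 < (t + 2) * (n - (t + 2)).choose (K - 1) := Nat.mul_pos (by omega) hYpos
    omega
  have hXr : (0 : ℝ) < X := by exact_mod_cast hXpos
  have hYr : (0 : ℝ) < (n - (t + 2)).choose (K - 1) := by exact_mod_cast hYpos
  have htr : (0 : ℝ) < t := by exact_mod_cast (by omega : 0 < t)
  have side : ∀ 𝒞 𝒟 : Finset (Finset ℕ), 𝒞 ⊆ powersetCard (t + K) (range n) → LeftClosed 𝒞 →
      Cross t 𝒞 𝒟 → (∀ A ∈ 𝒞, Hits (t + 1) A ∨ 2 * pre A (t + 2) = t + 2 + t) → _ :=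
    fun 𝒞 𝒟 h𝒞 hs hc htouch => exists_gain_loss (ℬ := 𝒟) (a := t + 1) (b := t + 1) (v := t) h𝒞
      (two_mul_le_of_le ht hK hn) hs hc (by omega) (by omega) (by omega) htouch
      (S := puncturedSegments t (t + 2)) (puncturedSegments_subset (by omega)) (by omega)
      (fun A hA P hP m hm => by
        have := pre_le A m
        have := pre_le P m
        have := pre_mono A hm.le
        rcases Nat.lt_or_ge m t with h | h
        · omega
        · have := pre_lt_of_mem_puncturedSegments hP h
          omega)
      (fun l hl => by omega)
      (fun l hl hlK => by
        rw [← hXdef, card_puncturedSegments (by omega), Nat.cast_mul,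
          show t + K - (t + l) = K - l by omega, show t + K - (t + 1) = K - 1 by omega]
        refine gain_lt_loss_of_le ht hl
          (Y := t * (n - (t + 2)).choose (K - 1) * X) (by positivity) ?_ ?_
        · have e1 : (t + 1) * (K - 1) + (t + 1) = (t + 1) * K := by
            rw [← Nat.mul_succ]; congr 1; omega
          have e2 : (t + 1) * K = t * K + K := by ring
          have h1 : (t : ℝ) ^ (l - 1) * n.choose (K - 1 - (l - 1)) ≤ n.choose (K - 1) := by
            exact_mod_cast pow_mul_choose_sub_le (l - 1) (by omega) (by omega)
          have h2 := choose_add_le_one_add_inv_pow (t := t) (N := n - (t + 2)) (m := K - 1) (t + 2)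
            (by omega) (by omega)
          rw [Nat.sub_add_cancel (by omega)] at h2
          have h3 := one_add_inv_pow_le_one_add_inv_pow (t := t) (show t + 2 ≤ t + 3 by omega)
          rw [show K - 1 - (l - 1) = K - l by omega] at h1
          obtain ⟨l', rfl⟩ : ∃ l', l = l' + 1 := ⟨l - 1, by omega⟩
          rw [Nat.add_sub_cancel] at h1
          calc (t : ℝ) ^ (l' + 1) * (n.choose (K - (l' + 1)) * X)
              = t * (t ^ l' * n.choose (K - (l' + 1))) * X := by ring
            _ ≤ t * ((1 + 1 / (t : ℝ)) ^ (t + 3) * (n - (t + 2)).choose (K - 1)) * X :=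
                mul_le_mul_of_nonneg_right (mul_le_mul_of_nonneg_left
                  (h1.trans (h2.trans (by gcongr))) htr.le) hXr.le
            _ = _ := by ring
        · have e1 : t * (K - 1) + t = t * K := by rw [← Nat.mul_succ]; congr 1; omega
          have h1 := le_choose_sub_reflBinom (t := t) (N := n - (t + 2 + l + 1)) (m := K - 1)
            (l + 1) (by omega) (by omega)
          rw [show n - (t + 2 + l + 1) + (l + 1) = n - (t + 2) by omega] at h1
          calc _ = t * (((t - 1 : ℝ) / t) ^ (l + 1) * ((t - 2) / (t - 1)) *
                (n - (t + 2)).choose (K - 1)) * X := by ring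
            _ ≤ _ := by gcongr)
  have hne : (slice n (t + K) (t + 1) (range (t + 2))).Nonempty := card_pos.1 hXpos
  have h := card_mul_card_le_of_gain_loss hne hne (side 𝒜 ℬ h𝒜 hs𝒜 hc ht𝒜)
    (side ℬ 𝒜 hℬ hsℬ hc.symm htℬ)
  rw [← hXdef] at h
  have hXX : X * X ≤ (n - t).choose K ^ 2 := by rw [sq]; exact Nat.mul_le_mul hXM hXM
  refine ⟨h.1.trans hXX, fun heq => ?_⟩
  refine ⟨hXM'.1 ?_, h.2 (by have := h.1; omega)⟩
  have : (n - t).choose K ^ 2 ≤ X * X := by rw [← heq]; exact h.1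
  nlinarith

/-- One family touches at the point `(0, t + 1)`, the other one at `(1, t)`. -/
lemma card_mul_card_lt_of_touch_zero_one (ht : 14 ≤ t) (hK : t + 1 ≤ K)
    (hn : (t + 1) * (K + 1) ≤ n)
    (h𝒜 : 𝒜 ⊆ powersetCard (t + K) (range n)) (hℬ : ℬ ⊆ powersetCard (t + K) (range n))
    (hs𝒜 : LeftClosed 𝒜) (hsℬ : LeftClosed ℬ) (hc : Cross t 𝒜 ℬ)
    (ht𝒜 : ∀ A ∈ 𝒜, Hits (t + 1 + 1) A ∨ 2 * pre A (t + 1) = t + 1 + (t + 1))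
    (htℬ : ∀ B ∈ ℬ, Hits (t - 1 + 1) B ∨ 2 * pre B (t + 1) = t + 1 + (t - 1)) :
    𝒜.card * ℬ.card < (n - t).choose K ^ 2 := by
  have h0 := mul_add_le_of_le hn
  have h14 : 14 * K ≤ t * K := Nat.mul_le_mul_right K ht
  have hX : (slice n (t + K) (t + 1) (range (t + 1))).card = (n - (t + 1)).choose (K - 1) := by
    rw [card_slice_range_self (by omega) (by omega), show t + K - (t + 1) = K - 1 by omega]
  have hY : (slice n (t + K) t (range (t + 1))).card =
      (t + 1) * (n - (t + 1)).choose K + (n - (t + 1)).choose (K - 1) := by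
    rw [card_slice_range_succ (by omega) (by omega), show t + K - (t + 1) = K - 1 by omega,
      Nat.add_sub_cancel_left]
  have hM : (n - t).choose K = (n - (t + 1)).choose (K - 1) + (n - (t + 1)).choose K := by
    obtain ⟨k', rfl⟩ : ∃ k', K = k' + 1 := ⟨K - 1, by omega⟩
    rw [show n - t = n - (t + 1) + 1 by omega, Nat.choose_succ_succ', Nat.add_sub_cancel]
  have e1 : (t + 1) * K = t * K + K := by ring
  have h12 : t * (n - (t + 1)).choose (K - 1) ≤ (n - (t + 1)).choose K :=
    mul_choose_sub_one_le (by omega) (by omega)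
  have hpos1 : 0 < (n - (t + 1)).choose (K - 1) := Nat.choose_pos (by omega)
  have hpos2 : 0 < (n - (t + 1)).choose K := Nat.choose_pos (by omega)
  set p := (n - (t + 1)).choose (K - 1) with hp
  set q := (n - (t + 1)).choose K with hq
  have hpr : (0 : ℝ) < p := by exact_mod_cast hpos1
  have hqr : (0 : ℝ) < q := by exact_mod_cast hpos2
  have htr : (14 : ℝ) ≤ t := by exact_mod_cast ht
  have ht0 : (0 : ℝ) < t := by linarith
  have h12r : (t : ℝ) * p ≤ q := by exact_mod_cast h12
  have side1 := exists_gain_loss (ℬ := ℬ) (a := t + 1) (b := t) (v := t - 1) h𝒜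
      (two_mul_le_of_le ht hK hn) hs𝒜 hc (by omega) (by omega) (by omega) ht𝒜
      (S := puncturedSegments t (t + 1)) (puncturedSegments_subset (by omega)) (by omega)
      (fun A hA P hP m hm => by
        have := pre_le A m
        have := pre_le P m
        rcases Nat.lt_or_ge m t with h | h
        · omega
        · have := pre_lt_of_mem_puncturedSegments hP h
          omega)
      (fun l hl => by omega)
      (fun l hl hlK => by
        rw [hX, hY, card_puncturedSegments (by omega), Nat.cast_mul,
          show t + K - (t + 1 + l) = K - 1 - l by omega, Nat.add_sub_cancel_left]
        refine gain_lt_loss_of_le ht hl (Y := t * q * p) (by positivity) ?_ ?_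
        · have e2 : (t + 1) * (K - 1) + (t + 1) = (t + 1) * K := by
            rw [← Nat.mul_succ]; congr 1; omega
          have h1 : (t : ℝ) ^ l * n.choose (K - 1 - l) ≤ n.choose (K - 1) := by
            exact_mod_cast pow_mul_choose_sub_le l (by omega) (by omega)
          have h2 := choose_add_le_one_add_inv_pow (t := t) (N := n - (t + 1)) (m := K - 1) (t + 1)
            (by omega) (by omega)
          rw [Nat.sub_add_cancel (by omega), ← hp] at h2
          have h3 : (((t + 1) * q + p : ℕ) : ℝ) ≤ (1 + 1 / (t : ℝ)) ^ 2 * (t * q) := by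
            have h4 : (1 + 1 / (t : ℝ)) ^ 2 * (t * q) = (t + 2) * q + q / t := by
              field_simp; ring
            have h5 : (0 : ℝ) ≤ q / t := by positivity
            have h6 : (p : ℝ) ≤ t * p := by nlinarith
            push_cast
            rw [h4]
            linarith
          calc (t : ℝ) ^ l * (n.choose (K - 1 - l) * (((t + 1) * q + p : ℕ) : ℝ))
              = (t ^ l * n.choose (K - 1 - l)) * (((t + 1) * q + p : ℕ) : ℝ) := by ring
            _ ≤ ((1 + 1 / (t : ℝ)) ^ (t + 1) * p) * ((1 + 1 / (t : ℝ)) ^ 2 * (t * q)) :=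
                mul_le_mul (h1.trans h2) h3 (by positivity) (by positivity)
            _ = _ := by ring
        · have h1 := le_choose_sub_reflBinom (t := t) (N := n - (t + 1 + l + 1)) (m := K)
            (l + 1) (by omega) (by omega)
          rw [show n - (t + 1 + l + 1) + (l + 1) = n - (t + 1) by omega, ← hq] at h1
          calc _ = t * (((t - 1 : ℝ) / t) ^ (l + 1) * ((t - 2) / (t - 1)) * q) * p := by ring
            _ ≤ _ := by gcongr)
  have side2 := exists_gain_loss (ℬ := 𝒜) (a := t) (b := t + 1) (v := t + 1) hℬ
      (two_mul_le_of_le ht hK hn) hsℬ hc.symm (by omega) (by omega) (by omega) htℬ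
      (S := {range (t + 1)}) (by simp) (by omega)
      (fun B hB P hP m hm => by
        have := pre_le B m
        have := pre_le P m
        have := pre_mono B hm.le
        omega)
      (fun l hl => by omega)
      (fun l hl hlK => by
        rw [hX, hY, card_singleton, one_mul,
          show t + K - (t - 1 + l) = K - (l - 1) by omega, show t + K - (t + 1) = K - 1 by omega]
        refine gain_lt_loss_of_le ht hl (Y := p * (t * q)) (by positivity) ?_ ?_
        · have h1 : (t : ℝ) ^ (l - 1) * n.choose (K - (l - 1)) ≤ n.choose K := by
            exact_mod_cast pow_mul_choose_sub_le (l - 1) (by omega) (by omega)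
          have h2 := choose_add_le_one_add_inv_pow (t := t) (N := n - (t + 1)) (m := K) (t + 1)
            (by omega) (by omega)
          rw [Nat.sub_add_cancel (by omega), ← hq] at h2
          have h3 := one_add_inv_pow_le_one_add_inv_pow (t := t) (show t + 1 ≤ t + 3 by omega)
          obtain ⟨l', rfl⟩ : ∃ l', l = l' + 1 := ⟨l - 1, by omega⟩
          rw [Nat.add_sub_cancel] at h1 ⊢
          calc (t : ℝ) ^ (l' + 1) * (n.choose (K - l') * p)
              = t * (t ^ l' * n.choose (K - l')) * p := by ring
            _ ≤ t * ((1 + 1 / (t : ℝ)) ^ (t + 3) * q) * p :=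
                mul_le_mul_of_nonneg_right (mul_le_mul_of_nonneg_left
                  (h1.trans (h2.trans (by gcongr))) ht0.le) hpr.le
            _ = _ := by ring
        · have e2 : t * (K - 1) + t = t * K := by rw [← Nat.mul_succ]; congr 1; omega
          have h1 := le_choose_sub_reflBinom (t := t) (N := n - (t + 1 + l + 1)) (m := K - 1)
            (l + 1) (by omega) (by omega)
          rw [show n - (t + 1 + l + 1) + (l + 1) = n - (t + 1) by omega, ← hp] at h1
          have h2 : (t : ℝ) * q ≤ (((t + 1) * q + p : ℕ) : ℝ) := by
            push_cast
            linarith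
          rw [← mul_assoc]
          gcongr)
  have hne1 : (slice n (t + K) (t + 1) (range (t + 1))).Nonempty :=
    card_pos.1 (by rw [hX]; exact hpos1)
  have hne2 : (slice n (t + K) t (range (t + 1))).Nonempty :=
    card_pos.1 (by rw [hY]; omega)
  have h := (card_mul_card_le_of_gain_loss hne1 hne2 side1 side2).1
  rw [hX, hY] at h
  refine h.trans_lt ?_
  rw [hM]
  -- the product of the slices is smaller by `q * (q - (t - 1) * p)`
  nlinarith

end

/-! ### Shifted families: the theorem -/

section

variable {t K n : ℕ} {𝒜 ℬ : Finset (Finset ℕ)}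

/-- The case of a common touching point, for `v ≤ u`. -/
lemma card_mul_card_le_of_common_touch (ht : 14 ≤ t) (hK : t + 1 ≤ K)
    (hn : (t + 1) * (K + 1) ≤ n)
    (h𝒜 : 𝒜 ⊆ powersetCard (t + K) (range n)) (hℬ : ℬ ⊆ powersetCard (t + K) (range n))
    (hs𝒜 : LeftClosed 𝒜) (hsℬ : LeftClosed ℬ) (hc : Cross t 𝒜 ℬ) {u v j : ℕ}
    (huv : u + v = 2 * t) (hvu : v ≤ u)
    (ht𝒜 : ∀ A ∈ 𝒜, Hits (u + 1) A ∨ 2 * pre A j = j + u)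
    (htℬ : ∀ B ∈ ℬ, Hits (v + 1) B ∨ 2 * pre B j = j + v)
    (he𝒜 : ∃ A ∈ 𝒜, 2 * pre A j = j + u) :
    𝒜.card * ℬ.card ≤ (n - t).choose K ^ 2 ∧
      (𝒜.card * ℬ.card = (n - t).choose K ^ 2 → ∃ r, (r = 0 ∨ r = 1 ∧ n = (t + 1) * (K + 1)) ∧
        𝒜 = slice n (t + K) (t + r) (range (t + 2 * r)) ∧
        ℬ = slice n (t + K) (t + r) (range (t + 2 * r))) := by
  have h2k := two_mul_le_of_le ht hK hn
  obtain ⟨A, hA, hAj⟩ := he𝒜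
  have hAk := (mem_powersetCard.1 (h𝒜 hA)).2
  have hp1 := pre_le_card A j
  have hp2 := pre_le A j
  obtain ⟨s, rfl⟩ : ∃ s, u = t + s := ⟨u - t, by omega⟩
  obtain rfl : v = t - s := by omega
  obtain ⟨i, rfl⟩ : ∃ i, j = t + s + 2 * i := ⟨j - pre A j, by omega⟩
  rcases Nat.lt_or_ge (i + s) 2 with his | his
  · have hcases : (i = 0 ∧ s = 0) ∨ (i = 1 ∧ s = 0) ∨ (i = 0 ∧ s = 1) := by omega
    rcases hcases with ⟨rfl, rfl⟩ | ⟨rfl, rfl⟩ | ⟨rfl, rfl⟩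
    · have h := card_mul_card_le_of_touch_zero ht hK hn h𝒜 hℬ hs𝒜 hsℬ hc ht𝒜 htℬ
      exact ⟨h.1, fun he => ⟨0, Or.inl rfl, h.2 he⟩⟩
    · have h := card_mul_card_le_of_touch_one ht hK hn h𝒜 hℬ hs𝒜 hsℬ hc ht𝒜 htℬ
      exact ⟨h.1, fun he => ⟨1, Or.inr ⟨rfl, (h.2 he).1⟩, (h.2 he).2⟩⟩
    · have h := card_mul_card_lt_of_touch_zero_one ht hK hn h𝒜 hℬ hs𝒜 hsℬ hc ht𝒜 htℬ
      exact ⟨h.le, fun he => absurd he h.ne⟩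
  · have h1 := card_le_of_forall_touch (i := i) h𝒜 h2k (by omega) (by omega) ht𝒜
    have e : t - s + 2 * (i + s) = t + s + 2 * i := by omega
    have h2 := card_le_of_forall_touch (u := t - s) (i := i + s) hℬ h2k (by omega) (by omega)
      (by rw [e]; exact htℬ)
    rw [e, show t + K - (t - s + 1) = K - 1 + s by omega,
      show t + K - (t - s + (i + s)) = K - i by omega] at h2
    rw [show t + K - (t + s + 1) = K - 1 - s by omega,
      show t + K - (t + s + i) = K - s - i by omega] at h1
    have h := (Nat.mul_le_mul h1 h2).trans_lt
      (touch_product_lt ht hK hn (by omega) his (by omega))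
    exact ⟨h.le, fun he => absurd he h.ne⟩

theorem card_mul_card_le_of_leftClosed (ht : 14 ≤ t) (hK : t + 1 ≤ K)
    (hn : (t + 1) * (K + 1) ≤ n)
    (h𝒜 : 𝒜 ⊆ powersetCard (t + K) (range n)) (hℬ : ℬ ⊆ powersetCard (t + K) (range n))
    (hs𝒜 : LeftClosed 𝒜) (hsℬ : LeftClosed ℬ) (hc : Cross t 𝒜 ℬ) :
    𝒜.card * ℬ.card ≤ (n - t).choose K ^ 2 ∧
      (𝒜.card * ℬ.card = (n - t).choose K ^ 2 → ∃ r, (r = 0 ∨ r = 1 ∧ n = (t + 1) * (K + 1)) ∧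
        𝒜 = slice n (t + K) (t + r) (range (t + 2 * r)) ∧
        ℬ = slice n (t + K) (t + r) (range (t + 2 * r))) := by
  classical
  have h2k := two_mul_le_of_le ht hK hn
  have strict : ∀ {P : Prop}, 𝒜.card * ℬ.card < (n - t).choose K ^ 2 →
      𝒜.card * ℬ.card ≤ (n - t).choose K ^ 2 ∧ (𝒜.card * ℬ.card = (n - t).choose K ^ 2 → P) :=
    fun h => ⟨h.le, fun he => absurd he h.ne⟩
  by_cases hhigh : ∃ u v, u + v = 2 * t + 1 ∧ (∀ A ∈ 𝒜, Hits u A) ∧ ∀ B ∈ ℬ, Hits v B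
  · obtain ⟨u, v, huv, hu, hv⟩ := hhigh
    refine strict (lt_of_le_of_lt (Nat.mul_le_mul (card_le_of_forall_hits h𝒜 h2k hu)
      (card_le_of_forall_hits hℬ h2k hv)) ?_)
    have := two_mul_choose_mul_choose_lt ht hK hn huv
    omega
  have hmax : ∀ 𝒞 : Finset (Finset ℕ), ¬ (∀ C ∈ 𝒞, Hits (2 * t + 1) C) →
      ∃ u ≤ 2 * t, (∀ C ∈ 𝒞, Hits u C) ∧ ∃ C ∈ 𝒞, ¬ Hits (u + 1) C := by
    intro 𝒞 h𝒞
    have hex : ∃ u, ¬ ∀ C ∈ 𝒞, Hits (u + 1) C := ⟨2 * t, h𝒞⟩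
    obtain ⟨m, hm, hmin⟩ : ∃ m, (¬ ∀ C ∈ 𝒞, Hits (m + 1) C) ∧
        ∀ m' < m, ∀ C ∈ 𝒞, Hits (m' + 1) C :=
      ⟨Nat.find hex, Nat.find_spec hex, fun m' h => not_not.1 (Nat.find_min hex h)⟩
    refine ⟨m, ?_, ?_, ?_⟩
    · by_contra! h
      exact h𝒞 (hmin _ h)
    · rcases m with _ | m
      · exact fun C _ => hits_zero C
      · exact hmin m (Nat.lt_succ_self m)
    · by_contra! h
      exact hm h
  obtain ⟨u, hu, hu𝒜, A₀, hA₀, hA₀'⟩ := hmax 𝒜 fun h =>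
    hhigh ⟨2 * t + 1, 0, rfl, h, fun B _ => hits_zero B⟩
  obtain ⟨v, hv, hvℬ, B₀, hB₀, hB₀'⟩ := hmax ℬ fun h =>
    hhigh ⟨0, 2 * t + 1, by omega, fun A _ => hits_zero A, h⟩
  have huv : u + v = 2 * t := by
    apply le_antisymm
    · by_contra! h
      exact hhigh ⟨2 * t + 1 - v, v, by omega, fun A hA => (hu𝒜 A hA).mono (by omega), hvℬ⟩
    · obtain ⟨m, hm⟩ := exists_add_le_pre_add_pre hs𝒜 hc hA₀ hB₀
      have := two_mul_pre_le_of_not_hits hA₀' m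
      have := two_mul_pre_le_of_not_hits hB₀' m
      omega
  by_cases h𝒜2 : ∀ A ∈ 𝒜, HitsTwice u A
  · refine strict (lt_of_le_of_lt (Nat.mul_le_mul (card_le_of_forall_hitsTwice h𝒜 h2k h𝒜2)
      (card_le_of_forall_hits hℬ h2k hvℬ)) ?_)
    rw [mul_assoc]
    exact two_mul_choose_mul_choose_lt ht hK hn (by omega)
  by_cases hℬ2 : ∀ B ∈ ℬ, HitsTwice v B
  · refine strict (lt_of_le_of_lt (Nat.mul_le_mul (card_le_of_forall_hits h𝒜 h2k hu𝒜)
      (card_le_of_forall_hitsTwice hℬ h2k hℬ2)) ?_)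
    rw [mul_left_comm]
    exact two_mul_choose_mul_choose_lt ht hK hn (by omega)
  push Not at h𝒜2 hℬ2
  obtain ⟨j, hj𝒜, hjℬ, hje𝒜, hjeℬ⟩ := exists_common_touch hs𝒜 hc huv h𝒜2 hℬ2
  rcases le_total v u with hvu | hvu
  · exact card_mul_card_le_of_common_touch ht hK hn h𝒜 hℬ hs𝒜 hsℬ hc huv hvu hj𝒜 hjℬ hje𝒜
  · have h := card_mul_card_le_of_common_touch ht hK hn hℬ h𝒜 hsℬ hs𝒜 hc.symm (by omega) hvu
      hjℬ hj𝒜 hjeℬ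
    rw [mul_comm ℬ.card] at h
    exact ⟨h.1, fun he => (h.2 he).imp fun r hr => ⟨hr.1, hr.2.2, hr.2.1⟩⟩

end

/-! ### Shifting -/

/-- The image of `F` under the transposition of `i` and `j`. -/
def swapSet (i j : ℕ) (F : Finset ℕ) : Finset ℕ := F.map (Equiv.swap i j).toEmbedding

section

variable {i j : ℕ} {F G : Finset ℕ}

lemma mem_swapSet {x : ℕ} : x ∈ swapSet i j F ↔ Equiv.swap i j x ∈ F := by
  rw [swapSet, mem_map_equiv, Equiv.symm_swap]

lemma left_mem_swapSet : i ∈ swapSet i j F ↔ j ∈ F := by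
  rw [mem_swapSet, Equiv.swap_apply_left]

lemma right_mem_swapSet : j ∈ swapSet i j F ↔ i ∈ F := by
  rw [mem_swapSet, Equiv.swap_apply_right]

lemma mem_swapSet_of_ne {x : ℕ} (hi : x ≠ i) (hj : x ≠ j) : x ∈ swapSet i j F ↔ x ∈ F := by
  rw [mem_swapSet, Equiv.swap_apply_of_ne_of_ne hi hj]

@[simp] lemma swapSet_swapSet : swapSet i j (swapSet i j F) = F := by
  ext x; rw [mem_swapSet, mem_swapSet, Equiv.swap_apply_self]

lemma card_swapSet : (swapSet i j F).card = F.card := card_map _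

lemma swapSet_inter : swapSet i j F ∩ swapSet i j G = swapSet i j (F ∩ G) := by
  ext x; simp only [mem_inter, mem_swapSet]

lemma card_swapSet_inter_swapSet : (swapSet i j F ∩ swapSet i j G).card = (F ∩ G).card := by
  rw [swapSet_inter, card_swapSet]

lemma swapSet_eq_self (h : i ∈ F ↔ j ∈ F) : swapSet i j F = F := by
  ext x
  rcases eq_or_ne x i with rfl | hi
  · rw [left_mem_swapSet, h]
  rcases eq_or_ne x j with rfl | hj
  · rw [right_mem_swapSet, h]
  exact mem_swapSet_of_ne hi hj

lemma swapSet_eq_insert_erase (hj : j ∈ F) (hi : i ∉ F) :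
    swapSet i j F = insert i (F.erase j) := by
  have hij : i ≠ j := fun h => hi (h ▸ hj)
  ext x
  rw [mem_insert, mem_erase]
  rcases eq_or_ne x i with rfl | hxi
  · simp [left_mem_swapSet, hj]
  rcases eq_or_ne x j with rfl | hxj
  · simp [right_mem_swapSet, hi, hxi]
  simp [mem_swapSet_of_ne hxi hxj, hxi, hxj]

lemma swapSet_subset_range {n : ℕ} (hi : i < n) (hj : j < n) (hF : F ⊆ range n) :
    swapSet i j F ⊆ range n := by
  intro x hx
  rw [mem_range]
  rcases eq_or_ne x i with rfl | hxi
  · exact hi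
  rcases eq_or_ne x j with rfl | hxj
  · exact hj
  exact mem_range.1 (hF ((mem_swapSet_of_ne hxi hxj).1 hx))

lemma swapSet_mem_powersetCard {n k : ℕ} (hi : i < n) (hj : j < n)
    (hF : F ∈ powersetCard k (range n)) : swapSet i j F ∈ powersetCard k (range n) := by
  rw [mem_powersetCard] at hF ⊢
  exact ⟨swapSet_subset_range hi hj hF.1, by rw [card_swapSet, hF.2]⟩

/-- The shift replacing `j` by `i`, whenever this gives a new set. -/
def shift (i j : ℕ) (𝒜 : Finset (Finset ℕ)) : Finset (Finset ℕ) := UV.compression {i} {j} 𝒜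

lemma compress_singleton (F : Finset ℕ) :
    UV.compress {i} {j} F = if j ∈ F ∧ i ∉ F then swapSet i j F else F := by
  unfold UV.compress
  by_cases h : j ∈ F ∧ i ∉ F
  · have h' : Disjoint {i} F ∧ {j} ≤ F := by simpa using h.symm
    rw [if_pos h, if_pos h', swapSet_eq_insert_erase h.1 h.2]
    have hij : i ≠ j := fun e => h.2 (e ▸ h.1)
    ext x
    simp only [sup_eq_union, mem_sdiff, mem_union, mem_singleton, mem_insert, mem_erase]
    constructor
    · rintro ⟨h1 | h1, h2⟩
      · exact Or.inr ⟨h2, h1⟩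
      · exact Or.inl h1
    · rintro (rfl | h1)
      · exact ⟨Or.inr rfl, hij⟩
      · exact ⟨Or.inl h1.2, h1.1⟩
  · have h' : ¬ (Disjoint {i} F ∧ {j} ≤ F) := by
      simpa [and_comm] using h
    rw [if_neg h, if_neg h']

variable {𝒜 ℬ : Finset (Finset ℕ)}

lemma mem_shift_iff : F ∈ shift i j 𝒜 ↔
    if j ∈ F ∧ i ∉ F then F ∈ 𝒜 ∧ swapSet i j F ∈ 𝒜
    else F ∈ 𝒜 ∨ (i ∈ F ∧ j ∉ F ∧ swapSet i j F ∈ 𝒜) := by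
  rw [shift, UV.mem_compression]
  simp only [compress_singleton]
  split_ifs with h
  · constructor
    · rintro (h1 | ⟨h1, G, hG, h2⟩)
      · exact h1
      · split_ifs at h2 with h3
        · rw [← h2, right_mem_swapSet] at h
          exact absurd h.1 h3.2
        · exact absurd (h2 ▸ hG) h1
    · exact Or.inl
  · constructor
    · rintro (h1 | ⟨h1, G, hG, h2⟩)
      · exact Or.inl h1.1
      · split_ifs at h2 with h3
        · subst h2
          rw [swapSet_swapSet, left_mem_swapSet, right_mem_swapSet]
          exact Or.inr ⟨h3.1, h3.2, hG⟩
        · exact absurd (h2 ▸ hG) h1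
    · rintro (h1 | ⟨h1, h2, h3⟩)
      · exact Or.inl ⟨h1, h1⟩
      · by_cases hF : F ∈ 𝒜
        · exact Or.inl ⟨hF, hF⟩
        · refine Or.inr ⟨hF, _, h3, ?_⟩
          rw [if_pos ⟨right_mem_swapSet.2 h1, fun h => h2 (left_mem_swapSet.1 h)⟩, swapSet_swapSet]

lemma mem_of_mem_shift_of_right (hF : F ∈ shift i j 𝒜) (hj : j ∈ F) (hi : i ∉ F) :
    F ∈ 𝒜 ∧ swapSet i j F ∈ 𝒜 := by
  rw [mem_shift_iff, if_pos ⟨hj, hi⟩] at hF; exact hF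

lemma mem_or_of_mem_shift_of_left (hF : F ∈ shift i j 𝒜) (hi : i ∈ F) :
    F ∈ 𝒜 ∨ swapSet i j F ∈ 𝒜 := by
  rw [mem_shift_iff, if_neg (fun h => h.2 hi)] at hF
  exact hF.imp_right fun h => h.2.2

lemma mem_of_mem_shift_of_iff (hF : F ∈ shift i j 𝒜) (h : i ∈ F ↔ j ∈ F) : F ∈ 𝒜 := by
  rw [mem_shift_iff, if_neg (by tauto)] at hF
  rcases hF with hF | hF
  · exact hF
  · exact absurd (h.1 hF.1) hF.2.1

lemma card_shift : (shift i j 𝒜).card = 𝒜.card := UV.card_compression _ _ _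

lemma shift_subset {n k : ℕ} (hi : i < n) (hj : j < n) (h𝒜 : 𝒜 ⊆ powersetCard k (range n)) :
    shift i j 𝒜 ⊆ powersetCard k (range n) := by
  intro F hF
  rw [mem_shift_iff] at hF
  split_ifs at hF with h
  · exact h𝒜 hF.1
  · rcases hF with hF | ⟨-, -, hF⟩
    · exact h𝒜 hF
    · have := swapSet_mem_powersetCard hi hj (h𝒜 hF)
      rwa [swapSet_swapSet] at this

/-- Shifting both families preserves cross `t`-intersection. -/
lemma cross_shift {t : ℕ} (hc : Cross t 𝒜 ℬ) : Cross t (shift i j 𝒜) (shift i j ℬ) := by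
  -- a set with `i` and without `j` meets another one in at least as much as its swap does
  have hU : ∀ A B : Finset ℕ, i ∈ A → j ∉ A → i ∈ B → j ∉ B →
      (swapSet i j A ∩ B).card ≤ (A ∩ B).card := by
    intro A B hiA hjA hiB hjB
    refine card_le_card fun x hx => ?_
    rw [mem_inter] at hx ⊢
    rcases eq_or_ne x i with rfl | hxi
    · exact ⟨hiA, hiB⟩
    rcases eq_or_ne x j with rfl | hxj
    · exact absurd hx.2 hjB
    exact ⟨(mem_swapSet_of_ne hxi hxj).1 hx.1, hx.2⟩
  have main : ∀ 𝒜 ℬ : Finset (Finset ℕ), Cross t 𝒜 ℬ → ∀ A, A ∈ 𝒜 → ∀ B, B ∈ shift i j ℬ →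
      (j ∈ A → i ∉ A → swapSet i j A ∈ 𝒜) → t ≤ (A ∩ B).card := by
    intro 𝒜 ℬ hc A hA B hB hAD
    by_cases hB' : B ∈ ℬ
    · exact hc A hA B hB'
    rw [mem_shift_iff] at hB
    split_ifs at hB with h
    · exact absurd hB.1 hB'
    obtain ⟨hiB, hjB, hsB⟩ := hB.resolve_left hB'
    by_cases hiA : i ∈ A
    · by_cases hjA : j ∈ A
      · rw [← card_swapSet_inter_swapSet (i := i) (j := j), swapSet_eq_self (F := A) (by tauto)]
        exact hc A hA _ hsB
      · refine (hc A hA _ hsB).trans ?_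
        rw [inter_comm, inter_comm A]
        exact hU B A hiB hjB hiA hjA
    · by_cases hjA : j ∈ A
      · rw [← card_swapSet_inter_swapSet (i := i) (j := j)]
        exact hc _ (hAD hjA hiA) _ hsB
      · rw [← card_swapSet_inter_swapSet (i := i) (j := j), swapSet_eq_self (F := A) (by tauto)]
        exact hc A hA _ hsB
  intro A hA B hB
  have hdown : ∀ 𝒞 : Finset (Finset ℕ), ∀ F ∈ shift i j 𝒞, j ∈ F → i ∉ F →
      swapSet i j F ∈ 𝒞 := fun 𝒞 F hF hj hi => (mem_of_mem_shift_of_right hF hj hi).2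
  by_cases hA' : A ∈ 𝒜
  · exact main 𝒜 ℬ hc A hA' B hB (hdown 𝒜 A hA)
  by_cases hB' : B ∈ ℬ
  · rw [inter_comm]
    exact main ℬ 𝒜 hc.symm B hB' A hA (hdown ℬ B hB)
  have hsA : swapSet i j A ∈ 𝒜 := by
    rw [mem_shift_iff] at hA; split_ifs at hA; exacts [hA.2, (hA.resolve_left hA').2.2]
  have hsB : swapSet i j B ∈ ℬ := by
    rw [mem_shift_iff] at hB; split_ifs at hB; exacts [hB.2, (hB.resolve_left hB').2.2]
  rw [← card_swapSet_inter_swapSet (i := i) (j := j)]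
  exact hc _ hsA _ hsB

/-- The sum of all elements of all members: it decreases under shifts. -/
def weight (𝒜 : Finset (Finset ℕ)) : ℕ := ∑ A ∈ 𝒜, ∑ x ∈ A, x

lemma sum_swapSet_lt (hij : i < j) (hj : j ∈ F) (hi : i ∉ F) :
    ∑ x ∈ swapSet i j F, x < ∑ x ∈ F, x := by
  rw [swapSet_eq_insert_erase hj hi, sum_insert (by simp [hi]), ← add_sum_erase F (fun x => x) hj]
  omega

lemma weight_shift_lt (hij : i < j) (h : shift i j 𝒜 ≠ 𝒜) : weight (shift i j 𝒜) < weight 𝒜 := by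
  set c : Finset ℕ → Finset ℕ := UV.compress {i} {j} with hcdef
  have hcle : ∀ F, c F ≠ F → ∑ x ∈ c F, x < ∑ x ∈ F, x := by
    intro F hF
    rw [hcdef, compress_singleton] at hF ⊢
    split_ifs at hF ⊢ with h'
    · exact sum_swapSet_lt hij h'.1 h'.2
    · exact absurd rfl hF
  have hsplit : weight 𝒜 = ∑ A ∈ 𝒜 with c A ∈ 𝒜, ∑ x ∈ A, x + ∑ A ∈ 𝒜 with c A ∉ 𝒜, ∑ x ∈ A, x :=
    (sum_filter_add_sum_filter_not _ _ _).symm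
  have hshift : shift i j 𝒜 =
      (𝒜.filter (fun A => c A ∈ 𝒜)) ∪ (𝒜.filter (fun A => c A ∉ 𝒜)).image c := by
    rw [shift, UV.compression, filter_image]
  have hdisj : Disjoint (𝒜.filter (fun A => c A ∈ 𝒜)) ((𝒜.filter (fun A => c A ∉ 𝒜)).image c) := by
    rw [disjoint_left]
    intro A hA hA'
    obtain ⟨B, hB, rfl⟩ := mem_image.1 hA'
    exact (mem_filter.1 hB).2 (mem_filter.1 hA).1
  have hsum : weight (shift i j 𝒜) = ∑ A ∈ 𝒜 with c A ∈ 𝒜, ∑ x ∈ A, x +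
      ∑ A ∈ 𝒜 with c A ∉ 𝒜, ∑ x ∈ c A, x := by
    rw [weight, hshift, sum_union hdisj, sum_image]
    exact UV.compress_injOn
  rw [hsplit, hsum]
  refine Nat.add_lt_add_left (sum_lt_sum_of_nonempty ?_ ?_) _
  · by_contra hne
    rw [not_nonempty_iff_eq_empty] at hne
    apply h
    rw [hshift, hne, image_empty, union_empty, filter_eq_self]
    exact fun A hA => by
      by_contra hA'
      exact notMem_empty A (hne ▸ mem_filter.2 ⟨hA, hA'⟩)
  · intro A hA
    rw [mem_filter] at hA
    exact hcle A fun e => hA.2 (e.symm ▸ hA.1)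

lemma leftClosed_of_forall_shift_eq {n k : ℕ} (h𝒜 : 𝒜 ⊆ powersetCard k (range n))
    (h : ∀ i j, i < j → j < n → shift i j 𝒜 = 𝒜) : LeftClosed 𝒜 := by
  intro A hA i j hij hj hi
  have hjn : j < n := mem_range.1 ((mem_powersetCard.1 (h𝒜 hA)).1 hj)
  rw [← h i j hij hjn] at hA
  rw [← swapSet_eq_insert_erase hj hi]
  exact (mem_of_mem_shift_of_right hA hj hi).2

end

/-! ### Undoing a shift of an extremal family -/

section

variable {t K n r i j : ℕ} {𝒜 ℬ : Finset (Finset ℕ)} {T : Finset ℕ}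

lemma mem_slice {k h : ℕ} {F : Finset ℕ} :
    F ∈ slice n k h T ↔ F ∈ powersetCard k (range n) ∧ h ≤ (F ∩ T).card := mem_filter

lemma swapSet_mem_slice_swapSet {k h : ℕ} (hi : i < n) (hj : j < n) {F : Finset ℕ}
    (hF : F ∈ slice n k h T) : swapSet i j F ∈ slice n k h (swapSet i j T) := by
  rw [mem_slice] at hF ⊢
  rw [card_swapSet_inter_swapSet]
  exact ⟨swapSet_mem_powersetCard hi hj hF.1, hF.2⟩

/-- Adding `i ∈ T` to a set instead of `j ∉ T` does not leave the slice. -/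
lemma card_inter_le_card_swapSet_inter {F : Finset ℕ} (hjF : j ∈ F) (hiF : i ∉ F)
    (hT : j ∈ T → i ∈ T) : (F ∩ T).card ≤ (swapSet i j F ∩ T).card := by
  by_cases hjT : j ∈ T
  · rw [← card_swapSet_inter_swapSet (i := i) (j := j) (F := F),
      swapSet_eq_self (F := T) (by tauto)]
  · refine card_le_card fun x hx => ?_
    rw [mem_inter] at hx ⊢
    refine ⟨(mem_swapSet_of_ne ?_ ?_).2 hx.1, hx.2⟩
    · rintro rfl; exact hiF hx.1
    · rintro rfl; exact hjT hx.2

/-- If `i ∈ T` implies `j ∈ T`, then a family that shifts to the slice on `T` is this slice. -/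
lemma eq_slice_of_shift_eq_of_imp {k h : ℕ} (hi : i < n) (hj : j < n) (hT : i ∈ T → j ∈ T)
    (h𝒜 : shift i j 𝒜 = slice n k h T) : 𝒜 = slice n k h T := by
  refine (eq_of_subset_of_card_le (fun F hF => ?_) ?_).symm
  · by_cases hiF : i ∈ F
    · by_cases hjF : j ∈ F
      · exact mem_of_mem_shift_of_iff (h𝒜 ▸ hF) (by tauto)
      · have h1 : swapSet i j F ∈ slice n k h T := by
          rw [mem_slice] at hF ⊢
          refine ⟨swapSet_mem_powersetCard hi hj hF.1, hF.2.trans ?_⟩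
          have := card_inter_le_card_swapSet_inter (i := j) (j := i) hiF hjF hT
          rwa [show swapSet j i F = swapSet i j F by simp [swapSet, Equiv.swap_comm]] at this
        rw [← h𝒜] at h1
        have := (mem_of_mem_shift_of_right h1 (right_mem_swapSet.2 hiF)
          (fun h => hjF (left_mem_swapSet.1 h))).2
        rwa [swapSet_swapSet] at this
    · by_cases hjF : j ∈ F
      · exact (mem_of_mem_shift_of_right (h𝒜 ▸ hF) hjF hiF).1
      · exact mem_of_mem_shift_of_iff (h𝒜 ▸ hF) (by tauto)
  · rw [← h𝒜, card_shift]

/-- The members of the slice that leave it when `i ∈ T` is replaced by `j ∉ T`. -/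
def IsCritical (t K n r i j : ℕ) (T F : Finset ℕ) : Prop :=
  F ∈ powersetCard (t + K) (range n) ∧ (F ∩ T).card = t + r ∧ i ∈ F ∧ j ∉ F

/-- Any two critical sets have a common critical partner that meets each of them in exactly `t`
elements. -/
lemma exists_isCritical_card_inter_eq (hn : t + 2 * r + 1 + 3 * K ≤ n) (hr : 1 + r ≤ t)
    (hrK : r ≤ K) (hTn : T ⊆ range n) (hT : T.card = t + 2 * r) (hiT : i ∈ T) (hjT : j ∉ T)
    {F H : Finset ℕ} (hF : IsCritical t K n r i j T F) (hH : IsCritical t K n r i j T H) :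
    ∃ D, IsCritical t K n r i j T D ∧ (F ∩ D).card = t ∧ (H ∩ D).card = t := by
  have hTF : ∀ {G}, IsCritical t K n r i j T G → (T \ G).card = r ∧ (G \ T).card = K - r := by
    intro G hG
    have h1 := card_sdiff_add_card_inter T G
    have h2 := card_sdiff_add_card_inter G T
    have h3 := (mem_powersetCard.1 hG.1).2
    rw [inter_comm T G, hG.2.1] at h1
    rw [hG.2.1] at h2
    omega
  obtain ⟨Q, hQ1, hQT, hQ⟩ := exists_subsuperset_card_eq (s := insert i (T \ F ∪ T \ H)) (t := T)
    (n := t + r) (insert_subset hiT (union_subset sdiff_subset sdiff_subset))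
    (by
      have h1 := card_insert_le i (T \ F ∪ T \ H)
      have h2 := card_union_le (T \ F) (T \ H)
      have h3 := (hTF hF).1
      have h4 := (hTF hH).1
      omega)
    (by omega)
  obtain ⟨R, hR1, hR⟩ := exists_subset_card_eq (s := range n \ (insert j T ∪ (F \ T ∪ H \ T)))
    (n := K - r) (by
      have h1 := le_card_sdiff (insert j T ∪ (F \ T ∪ H \ T)) (range n)
      have h2 := card_union_le (insert j T) (F \ T ∪ H \ T)
      have h3 := card_union_le (F \ T) (H \ T)
      have h4 := card_insert_le j T
      have h5 := (hTF hF).2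
      have h6 := (hTF hH).2
      rw [card_range] at h1
      omega)
  have hRmem : ∀ x ∈ R, x < n ∧ x ≠ j ∧ x ∉ T ∧ x ∉ F ∧ x ∉ H := by
    intro x hx
    have h1 := hR1 hx
    simp only [mem_sdiff, mem_range, mem_union, mem_insert, not_or, not_and, not_not] at h1
    obtain ⟨h2, ⟨h3, h4⟩, h5, h6⟩ := h1
    exact ⟨h2, h3, h4, fun h => h4 (h5 h), fun h => h4 (h6 h)⟩
  have hdisj : Disjoint Q R := by
    rw [disjoint_left]; intro x hx hx'; exact (hRmem x hx').2.2.1 (hQT hx)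
  have hinter : ∀ {G}, IsCritical t K n r i j T G → T \ G ⊆ Q → (∀ x ∈ R, x ∉ G) →
      (G ∩ (Q ∪ R)).card = t := by
    intro G hG hGQ hGR
    have h1 : G ∩ (Q ∪ R) = Q \ (T \ G) := by
      ext x
      simp only [mem_inter, mem_union, mem_sdiff, not_and, not_not]
      constructor
      · rintro ⟨h2, h3 | h3⟩
        · exact ⟨h3, fun _ => h2⟩
        · exact absurd h2 (hGR x h3)
      · rintro ⟨h2, h3⟩; exact ⟨h3 (hQT h2), Or.inl h2⟩
    have h2 := card_sdiff_add_card_inter Q (T \ G)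
    rw [inter_eq_right.2 hGQ, (hTF hG).1, hQ] at h2
    rw [h1]; omega
  refine ⟨Q ∪ R, ⟨?_, ?_, ?_, ?_⟩, ?_, ?_⟩
  · rw [mem_powersetCard, card_union_of_disjoint hdisj]
    refine ⟨union_subset (hQT.trans hTn) fun x hx => mem_range.2 (hRmem x hx).1, by omega⟩
  · have h1 : (Q ∪ R) ∩ T = Q := by
      ext x
      rw [mem_inter, mem_union]
      constructor
      · rintro ⟨h2 | h2, h3⟩
        · exact h2
        · exact absurd h3 (hRmem x h2).2.2.1
      · exact fun h2 => ⟨Or.inl h2, hQT h2⟩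
    rw [h1, hQ]
  · exact mem_union_left _ (hQ1 (mem_insert_self _ _))
  · rw [mem_union, not_or]
    exact ⟨fun h => hjT (hQT h), fun h => (hRmem j h).2.1 rfl⟩
  · exact hinter hF (fun x hx => hQ1 (mem_insert_of_mem (mem_union_left _ hx)))
      fun x hx => (hRmem x hx).2.2.2.1
  · exact hinter hH (fun x hx => hQ1 (mem_insert_of_mem (mem_union_right _ hx)))
      fun x hx => (hRmem x hx).2.2.2.2

/-- If `F` and `D` both contain `i` but not `j`, replacing `i` by `j` in one of them loses a common
element. -/
lemma card_inter_swapSet_lt {F D : Finset ℕ} (hiF : i ∈ F) (hjF : j ∉ F) (hiD : i ∈ D)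
    (hjD : j ∉ D) : (F ∩ swapSet i j D).card < (F ∩ D).card := by
  refine card_lt_card ⟨fun x hx => ?_, fun h => ?_⟩
  · rw [mem_inter] at hx ⊢
    refine ⟨hx.1, (mem_swapSet_of_ne ?_ ?_).1 hx.2⟩
    · rintro rfl; exact hjD (left_mem_swapSet.1 hx.2)
    · rintro rfl; exact hjF hx.1
  · exact hjD (left_mem_swapSet.1 (mem_inter.1 (h (mem_inter.2 ⟨hiF, hiD⟩))).2)

/-- If both families shift to one and the same slice, then they were equal and isomorphic to this
slice before.  The only sets not determined by the shift are the critical ones `F`, of which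
either `F` or its swap belongs to the family; cross `t`-intersection forces the same choice for
all critical sets and both families. -/
lemma exists_eq_slice_of_shift_eq (hn : t + 2 * r + 1 + 3 * K ≤ n) (hr : 1 + r ≤ t)
    (hrK : r ≤ K) (hi : i < n) (hj : j < n) (hTn : T ⊆ range n) (hT : T.card = t + 2 * r)
    (hc : Cross t 𝒜 ℬ) (h𝒜 : shift i j 𝒜 = slice n (t + K) (t + r) T)
    (hℬ : shift i j ℬ = slice n (t + K) (t + r) T) :
    ∃ T' ⊆ range n, T'.card = t + 2 * r ∧ 𝒜 = slice n (t + K) (t + r) T' ∧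
      ℬ = slice n (t + K) (t + r) T' := by
  by_cases hiT : i ∈ T → j ∈ T
  · exact ⟨T, hTn, hT, eq_slice_of_shift_eq_of_imp hi hj hiT h𝒜,
      eq_slice_of_shift_eq_of_imp hi hj hiT hℬ⟩
  push Not at hiT
  obtain ⟨hiT, hjT⟩ := hiT
  have hcrit : ∀ {F}, IsCritical t K n r i j T F → F ∈ slice n (t + K) (t + r) T :=
    fun hF => mem_slice.2 ⟨hF.1, hF.2.1.ge⟩
  have hor : ∀ {𝒞 : Finset (Finset ℕ)}, shift i j 𝒞 = slice n (t + K) (t + r) T →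
      ∀ {F}, IsCritical t K n r i j T F → F ∈ 𝒞 ∨ swapSet i j F ∈ 𝒞 := fun h𝒞 F hF =>
    mem_or_of_mem_shift_of_left (h𝒞 ▸ hcrit hF) hF.2.2.1
  -- a noncritical member containing `i` but not `j` stays in the slice when swapped
  have hnon : ∀ {F}, F ∈ slice n (t + K) (t + r) T → i ∈ F → j ∉ F →
      ¬ IsCritical t K n r i j T F → swapSet i j F ∈ slice n (t + K) (t + r) T := by
    intro F hF hiF hjF hFc
    rw [mem_slice] at hF ⊢
    refine ⟨swapSet_mem_powersetCard hi hj hF.1, ?_⟩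
    have h1 : (F ∩ T).card ≠ t + r := fun h => hFc ⟨hF.1, h, hiF, hjF⟩
    have h2 : (F ∩ T).erase i ⊆ swapSet i j F ∩ T := by
      intro x hx
      rw [mem_erase, mem_inter] at hx
      refine mem_inter.2 ⟨(mem_swapSet_of_ne hx.1 ?_).2 hx.2.1, hx.2.2⟩
      rintro rfl; exact hjT hx.2.2
    have h3 := card_le_card h2
    rw [card_erase_of_mem (mem_inter.2 ⟨hiF, hiT⟩)] at h3
    omega
  have hsub : ∀ {𝒞 : Finset (Finset ℕ)}, shift i j 𝒞 = slice n (t + K) (t + r) T →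
      (∀ F, IsCritical t K n r i j T F → F ∈ 𝒞) → 𝒞 = slice n (t + K) (t + r) T := by
    intro 𝒞 h𝒞 hall
    refine (eq_of_subset_of_card_le (fun F hF => ?_) (by rw [← h𝒞, card_shift])).symm
    by_cases hFc : IsCritical t K n r i j T F
    · exact hall F hFc
    by_cases hiF : i ∈ F
    · by_cases hjF : j ∈ F
      · exact mem_of_mem_shift_of_iff (h𝒞 ▸ hF) (by tauto)
      · have h1 := hnon hF hiF hjF hFc
        rw [← h𝒞] at h1
        have := (mem_of_mem_shift_of_right h1 (right_mem_swapSet.2 hiF)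
          (fun h => hjF (left_mem_swapSet.1 h))).2
        rwa [swapSet_swapSet] at this
    · by_cases hjF : j ∈ F
      · exact (mem_of_mem_shift_of_right (h𝒞 ▸ hF) hjF hiF).1
      · exact mem_of_mem_shift_of_iff (h𝒞 ▸ hF) (by tauto)
  have hsub' : ∀ {𝒞 : Finset (Finset ℕ)}, shift i j 𝒞 = slice n (t + K) (t + r) T →
      (∀ F, IsCritical t K n r i j T F → F ∉ 𝒞) →
      𝒞 = slice n (t + K) (t + r) (swapSet i j T) := by
    intro 𝒞 h𝒞 hall
    refine (eq_of_subset_of_card_le (fun F hF => ?_) ?_).symm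
    · have hF' := swapSet_mem_slice_swapSet hi hj hF
      rw [swapSet_swapSet] at hF'
      have hF'' := hF'
      rw [← h𝒞] at hF''
      by_cases hFc : IsCritical t K n r i j T (swapSet i j F)
      · have := (hor h𝒞 hFc).resolve_left (hall _ hFc)
        rwa [swapSet_swapSet] at this
      by_cases hiF : i ∈ F
      · by_cases hjF : j ∈ F
        · rw [swapSet_eq_self (by tauto)] at hF''
          exact mem_of_mem_shift_of_iff hF'' (by tauto)
        · have := (mem_of_mem_shift_of_right hF'' (right_mem_swapSet.2 hiF)
            (fun h => hjF (left_mem_swapSet.1 h))).2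
          rwa [swapSet_swapSet] at this
      · by_cases hjF : j ∈ F
        · have h1 := hnon hF' (left_mem_swapSet.2 hjF) (fun h => hiF (right_mem_swapSet.1 h)) hFc
          rw [swapSet_swapSet, ← h𝒞] at h1
          exact (mem_of_mem_shift_of_right h1 hjF hiF).1
        · rw [swapSet_eq_self (by tauto)] at hF''
          exact mem_of_mem_shift_of_iff hF'' (by tauto)
    · rw [← card_shift (i := i) (j := j), h𝒞]
      refine card_le_card_of_injOn (swapSet i j) (fun F hF => ?_) fun F _ G _ h => ?_
      · exact swapSet_mem_slice_swapSet hi hj hF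
      · rw [← swapSet_swapSet (i := i) (j := j) (F := F), h, swapSet_swapSet]
  have hlink : ∀ {𝒞 𝒟 : Finset (Finset ℕ)}, Cross t 𝒞 𝒟 →
      shift i j 𝒟 = slice n (t + K) (t + r) T → ∀ {F D}, IsCritical t K n r i j T F →
      IsCritical t K n r i j T D → (F ∩ D).card = t → F ∈ 𝒞 → D ∈ 𝒟 := by
    intro 𝒞 𝒟 hcr h𝒟 F D hF hD hFD hF𝒞
    refine (hor h𝒟 hD).resolve_right fun h => ?_
    have h1 := hcr F hF𝒞 _ h
    have h2 := card_inter_swapSet_lt hF.2.2.1 hF.2.2.2 hD.2.2.1 hD.2.2.2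
    omega
  have hspread : ∀ {𝒞 𝒟 : Finset (Finset ℕ)}, Cross t 𝒞 𝒟 →
      shift i j 𝒞 = slice n (t + K) (t + r) T → shift i j 𝒟 = slice n (t + K) (t + r) T →
      ∀ {F H}, IsCritical t K n r i j T F → IsCritical t K n r i j T H → F ∈ 𝒞 → H ∈ 𝒞 := by
    intro 𝒞 𝒟 hcr h𝒞 h𝒟 F H hF hH hF𝒞
    obtain ⟨D, hD, hFD, hHD⟩ := exists_isCritical_card_inter_eq hn hr hrK hTn hT hiT hjT hF hH
    exact hlink hcr.symm h𝒞 hD hH (by rw [inter_comm, hHD]) (hlink hcr h𝒟 hF hD hFD hF𝒞)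
  have hsame : ∀ {F}, IsCritical t K n r i j T F → (F ∈ 𝒜 ↔ F ∈ ℬ) := by
    intro F hF
    obtain ⟨D, hD, hFD, -⟩ := exists_isCritical_card_inter_eq hn hr hrK hTn hT hiT hjT hF hF
    constructor
    · exact fun h => hspread hc.symm hℬ h𝒜 hD hF (hlink hc hℬ hF hD hFD h)
    · exact fun h => hspread hc h𝒜 hℬ hD hF (hlink hc.symm h𝒜 hF hD hFD h)
  by_cases hex : ∃ F, IsCritical t K n r i j T F ∧ F ∈ 𝒜
  · obtain ⟨F, hF, hF𝒜⟩ := hex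
    exact ⟨T, hTn, hT, hsub h𝒜 fun H hH => hspread hc h𝒜 hℬ hF hH hF𝒜,
      hsub hℬ fun H hH => (hsame hH).1 (hspread hc h𝒜 hℬ hF hH hF𝒜)⟩
  · push Not at hex
    exact ⟨swapSet i j T, swapSet_subset_range hi hj hTn, by rw [card_swapSet, hT],
      hsub' h𝒜 hex, hsub' hℬ fun F hF h => hex F hF ((hsame hF).2 h)⟩

/-- The theorem for families of finite sets of natural numbers. -/
theorem card_mul_card_le (ht : 14 ≤ t) (hK : t + 1 ≤ K) (hn : (t + 1) * (K + 1) ≤ n)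
    (h𝒜 : 𝒜 ⊆ powersetCard (t + K) (range n)) (hℬ : ℬ ⊆ powersetCard (t + K) (range n))
    (hc : Cross t 𝒜 ℬ) :
    𝒜.card * ℬ.card ≤ (n - t).choose K ^ 2 ∧
      (𝒜.card * ℬ.card = (n - t).choose K ^ 2 → ∃ r, (r = 0 ∨ r = 1 ∧ n = (t + 1) * (K + 1)) ∧
        ∃ T ⊆ range n, T.card = t + 2 * r ∧ 𝒜 = slice n (t + K) (t + r) T ∧
          ℬ = slice n (t + K) (t + r) T) := by
  induction hw : weight 𝒜 + weight ℬ using Nat.strong_induction_on generalizing 𝒜 ℬ with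
  | _ w ih =>
  have h0 := mul_add_le_of_le hn
  have h14 : 14 * K ≤ t * K := Nat.mul_le_mul_right K ht
  by_cases hst : ∃ i j, i < j ∧ j < n ∧ (shift i j 𝒜 ≠ 𝒜 ∨ shift i j ℬ ≠ ℬ)
  · obtain ⟨i, j, hij, hj, hne⟩ := hst
    have hle : ∀ 𝒞 : Finset (Finset ℕ), weight (shift i j 𝒞) ≤ weight 𝒞 := by
      intro 𝒞
      by_cases h : shift i j 𝒞 = 𝒞
      · rw [h]
      · exact (weight_shift_lt hij h).le
    have hlt : weight (shift i j 𝒜) + weight (shift i j ℬ) < w := by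
      have h1 := hle 𝒜
      have h2 := hle ℬ
      rcases hne with h | h
      · have := weight_shift_lt hij h; omega
      · have := weight_shift_lt hij h; omega
    have h := ih _ hlt (shift_subset (hij.trans hj) hj h𝒜) (shift_subset (hij.trans hj) hj hℬ)
      (cross_shift hc) rfl
    rw [card_shift, card_shift] at h
    refine ⟨h.1, fun he => ?_⟩
    obtain ⟨r, hr, T, hTn, hT, hA, hB⟩ := h.2 he
    exact ⟨r, hr, exists_eq_slice_of_shift_eq (by omega) (by omega) (by omega) (hij.trans hj) hj
      hTn hT hc hA hB⟩
  · push Not at hst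
    have h := card_mul_card_le_of_leftClosed ht hK hn h𝒜 hℬ
      (leftClosed_of_forall_shift_eq h𝒜 fun i j hij hj => (hst i j hij hj).1)
      (leftClosed_of_forall_shift_eq hℬ fun i j hij hj => (hst i j hij hj).2) hc
    refine ⟨h.1, fun he => ?_⟩
    obtain ⟨r, hr, hA, hB⟩ := h.2 he
    exact ⟨r, hr, range (t + 2 * r), range_subset_range.2 (by omega), card_range _, hA, hB⟩

end

/-! ### From natural numbers to `Fin n` -/

section

variable {n k : ℕ}

/-- The family `𝒜` of subsets of `Fin n` as a family of sets of natural numbers. -/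
def natFamily (𝒜 : Finset (Finset (Fin n))) : Finset (Finset ℕ) :=
  𝒜.map (mapEmbedding Fin.valEmbedding).toEmbedding

lemma map_mem_natFamily {𝒜 : Finset (Finset (Fin n))} {F : Finset (Fin n)} :
    F.map Fin.valEmbedding ∈ natFamily 𝒜 ↔ F ∈ 𝒜 :=
  mem_map' (mapEmbedding Fin.valEmbedding).toEmbedding

lemma card_natFamily (𝒜 : Finset (Finset (Fin n))) : (natFamily 𝒜).card = 𝒜.card := card_map _

lemma natFamily_inj {𝒜 ℬ : Finset (Finset (Fin n))} : natFamily 𝒜 = natFamily ℬ ↔ 𝒜 = ℬ := map_inj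

lemma natFamily_subset {𝒜 : Finset (Finset (Fin n))} (h : 𝒜 ⊆ uniformSets n k) :
    natFamily 𝒜 ⊆ powersetCard k (range n) := by
  intro F hF
  obtain ⟨A, hA, rfl⟩ := mem_map.1 hF
  refine mem_powersetCard.2 ⟨fun x hx => ?_, ?_⟩
  · obtain ⟨y, -, rfl⟩ := mem_map.1 hx
    exact mem_range.2 y.2
  · exact (card_map _).trans (mem_powersetCard.1 (h hA)).2

lemma cross_natFamily {t : ℕ} {𝒜 ℬ : Finset (Finset (Fin n))} (h : IsCrossIntersecting t 𝒜 ℬ) :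
    Cross t (natFamily 𝒜) (natFamily ℬ) := by
  intro F hF G hG
  obtain ⟨A, hA, rfl⟩ := mem_map.1 hF
  obtain ⟨B, hB, rfl⟩ := mem_map.1 hG
  change t ≤ (A.map Fin.valEmbedding ∩ B.map Fin.valEmbedding).card
  rw [← map_inter, card_map]
  exact h A hA B hB

/-- The trace on `Fin n` of a set of natural numbers. -/
def finTrace (n : ℕ) (T : Finset ℕ) : Finset (Fin n) := univ.filter (fun x => (x : ℕ) ∈ T)

lemma mem_finTrace {T : Finset ℕ} {x : Fin n} : x ∈ finTrace n T ↔ (x : ℕ) ∈ T := by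
  simp [finTrace]

lemma card_map_inter (F : Finset (Fin n)) (T : Finset ℕ) :
    (F.map Fin.valEmbedding ∩ T).card = (F ∩ finTrace n T).card := by
  rw [← card_map Fin.valEmbedding (s := F ∩ finTrace n T)]
  congr 1
  ext x
  simp only [mem_inter, mem_map, Fin.valEmbedding_apply, mem_finTrace]
  constructor
  · rintro ⟨⟨y, hy, rfl⟩, hT⟩; exact ⟨y, ⟨hy, hT⟩, rfl⟩
  · rintro ⟨y, ⟨hy, hT⟩, rfl⟩; exact ⟨⟨y, hy, rfl⟩, hT⟩

lemma card_finTrace {T : Finset ℕ} (hT : T ⊆ range n) : (finTrace n T).card = T.card := by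
  have h := card_map_inter (univ : Finset (Fin n)) T
  rw [univ_inter] at h
  rw [← h, inter_eq_right.2]
  intro x hx
  exact mem_map.2 ⟨⟨x, mem_range.1 (hT hx)⟩, mem_univ _, rfl⟩

lemma initSeg_eq_finTrace (m : ℕ) : initSeg n m = finTrace n (range m) := by
  ext x; simp [initSeg, finTrace]

lemma natFamily_filter_eq_slice (h : ℕ) (T : Finset ℕ) :
    natFamily ((uniformSets n k).filter (fun F => h ≤ (F ∩ finTrace n T).card)) =
      slice n k h T := by
  ext F
  rw [mem_slice]
  constructor
  · intro hF
    refine ⟨natFamily_subset (filter_subset _ _) hF, ?_⟩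
    obtain ⟨A, hA, rfl⟩ := mem_map.1 hF
    exact (mem_filter.1 hA).2.trans (card_map_inter A T).ge
  · rintro ⟨hF, hFT⟩
    obtain ⟨hFn, hFk⟩ := mem_powersetCard.1 hF
    have hmap : (finTrace n F).map Fin.valEmbedding = F := by
      ext x
      simp only [mem_map, mem_finTrace, Fin.valEmbedding_apply]
      constructor
      · rintro ⟨y, hy, rfl⟩; exact hy
      · exact fun hx => ⟨⟨x, mem_range.1 (hFn hx)⟩, hx, rfl⟩
    rw [← hmap, map_mem_natFamily, mem_filter, uniformSets, mem_powersetCard, card_finTrace hFn,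
      ← card_map_inter, hmap]
    exact ⟨⟨subset_univ _, hFk⟩, hFT⟩

lemma natFamily_frankl (t i : ℕ) :
    natFamily (frankl t i n k) = slice n k (t + i) (range (t + 2 * i)) := by
  rw [← natFamily_filter_eq_slice, ← initSeg_eq_finTrace, frankl]

/-- A slice on a set of `t + 2 * i` elements is isomorphic to the corresponding Frankl family. -/
lemma isomorphic_frankl_of_natFamily_eq {t i : ℕ} {𝒜 : Finset (Finset (Fin n))} {T : Finset ℕ}
    (hTn : T ⊆ range n) (hT : T.card = t + 2 * i) (h𝒜 : natFamily 𝒜 = slice n k (t + i) T) :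
    Isomorphic 𝒜 (frankl t i n k) := by
  rw [← natFamily_filter_eq_slice, natFamily_inj] at h𝒜
  have hle : t + 2 * i ≤ n := by
    have := card_le_card hTn
    rwa [card_range, hT] at this
  have hcard : (initSeg n (t + 2 * i)).card = (finTrace n T).card := by
    rw [initSeg_eq_finTrace, card_finTrace (range_subset_range.2 hle), card_finTrace hTn, hT,
      card_range]
  let e : {x // x ∈ initSeg n (t + 2 * i)} ≃ {x // x ∈ finTrace n T} := equivOfCardEq hcard
  let f : Equiv.Perm (Fin n) := e.extendSubtype
  have hf : ∀ x, f x ∈ finTrace n T ↔ x ∈ initSeg n (t + 2 * i) := by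
    intro x
    by_cases hx : x ∈ initSeg n (t + 2 * i)
    · exact iff_of_true (e.extendSubtype_mem x hx) hx
    · exact iff_of_false (e.extendSubtype_not_mem x hx) hx
  have hcardf : ∀ B : Finset (Fin n),
      (B.image f ∩ finTrace n T).card = (B ∩ initSeg n (t + 2 * i)).card := by
    intro B
    rw [← card_image_of_injective (B ∩ initSeg n (t + 2 * i)) f.injective]
    congr 1
    ext y
    simp only [mem_inter, mem_image]
    constructor
    · rintro ⟨⟨x, hx, rfl⟩, hy⟩; exact ⟨x, ⟨hx, (hf x).1 hy⟩, rfl⟩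
    · rintro ⟨x, ⟨hx, hx'⟩, rfl⟩; exact ⟨⟨x, hx, rfl⟩, (hf x).2 hx'⟩
  have hmem : ∀ B : Finset (Fin n), B.image f ∈ 𝒜 ↔ B ∈ frankl t i n k := by
    intro B
    rw [h𝒜, frankl, mem_filter, mem_filter, hcardf, uniformSets, mem_powersetCard,
      mem_powersetCard, card_image_of_injective B f.injective]
    simp
  refine ⟨f, ?_⟩
  ext F
  rw [mem_image]
  constructor
  · intro hF
    have hFF : (F.image f.symm).image f = F := by
      rw [image_image]; simp
    exact ⟨F.image f.symm, (hmem _).1 (by rwa [hFF]), hFF⟩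
  · rintro ⟨B, hB, rfl⟩
    exact (hmem B).2 hB

lemma Isomorphic.card_eq {𝒜 ℬ : Finset (Finset (Fin n))} (h : Isomorphic 𝒜 ℬ) :
    𝒜.card = ℬ.card := by
  obtain ⟨f, rfl⟩ := h
  exact card_image_of_injective _ (image_injective f.injective)

end

end CrossIntersecting

theorem mainTheorem7 (t : ℕ) (ht : 14 ≤ t) :
    ∃ k₀ : ℕ, t ≤ k₀ ∧ ∀ k : ℕ, k₀ < k → ∀ n : ℕ, (t + 1) * (k - t + 1) ≤ n →
      ∀ 𝒜 ℬ : Finset (Finset (Fin n)),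
        𝒜 ⊆ CrossIntersecting.uniformSets n k →
        ℬ ⊆ CrossIntersecting.uniformSets n k →
        CrossIntersecting.IsCrossIntersecting t 𝒜 ℬ →
        𝒜.card * ℬ.card ≤ (n - t).choose (k - t) ^ 2 ∧
        (𝒜.card * ℬ.card = (n - t).choose (k - t) ^ 2 ↔
          (𝒜 = ℬ ∧ CrossIntersecting.Isomorphic 𝒜 (CrossIntersecting.frankl t 0 n k)) ∨
          (n = (t + 1) * (k - t + 1) ∧ 𝒜 = ℬ ∧
            CrossIntersecting.Isomorphic 𝒜 (CrossIntersecting.frankl t 1 n k))) := by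
  refine ⟨2 * t, by omega, fun k hk n hn 𝒜 ℬ h𝒜 hℬ hc => ?_⟩
  obtain ⟨K, rfl⟩ : ∃ K, k = t + K := ⟨k - t, by omega⟩
  rw [Nat.add_sub_cancel_left] at hn ⊢
  have hK : t + 1 ≤ K := by omega
  have h0 := CrossIntersecting.mul_add_le_of_le hn
  have h := CrossIntersecting.card_mul_card_le ht hK hn
    (CrossIntersecting.natFamily_subset h𝒜) (CrossIntersecting.natFamily_subset hℬ)
    (CrossIntersecting.cross_natFamily hc)
  rw [CrossIntersecting.card_natFamily, CrossIntersecting.card_natFamily] at h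
  refine ⟨h.1, fun he => ?_, ?_⟩
  · obtain ⟨r, hr, T, hTn, hT, hA, hB⟩ := h.2 he
    have hAB : 𝒜 = ℬ := CrossIntersecting.natFamily_inj.1 (hA.trans hB.symm)
    have hiso := CrossIntersecting.isomorphic_frankl_of_natFamily_eq hTn hT hA
    rcases hr with rfl | ⟨rfl, hr⟩
    · exact Or.inl ⟨hAB, hiso⟩
    · exact Or.inr ⟨hr, hAB, hiso⟩
  · rintro (⟨rfl, hiso⟩ | ⟨hnK, rfl, hiso⟩)
    · rw [hiso.card_eq, ← CrossIntersecting.card_natFamily, CrossIntersecting.natFamily_frankl,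
        mul_zero, add_zero, CrossIntersecting.card_slice_range_self (by omega) (by omega),
        Nat.add_sub_cancel_left, sq]
    · rw [hiso.card_eq, ← CrossIntersecting.card_natFamily, CrossIntersecting.natFamily_frankl,
        mul_one, (CrossIntersecting.card_slice_range_add_two ht hK hn).2.2 hnK, sq]
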